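/- Let $n\ge 1$, let $U\subset\mathbb R^n$ be open and let $g$ be a smooth Riemannian metric on $U$ all of whose sectional curvatures equal $-1$. Let $e_1,\dots,e_n$ be a smooth $g$-orthonormal frame on $U$, with dual forms $\omega_i$ (so $\omega_i(e_j)=\delta_{ij}$), connection forms $\omega_{ij}(X)=g(\nabla_X e_i,e_j)$, where $\nabla$ is the Levi-Civita connection of $g$, and $W=(\omega_{ij})$. For an open set $V\subset U$ and a differentiable map $L:V\to O(n)$ consider the system $$(dL\,L^t)_{1i}+(LWL^t)_{1i}+\sum_{k=1}^n L_{ik}\,\omega_k=0\quad (i\ge 2),\qquad (dL\,L^t)_{ij}+(LWL^t)_{ij}=0\quad (i,j\ge 2,\ i\ne j).\tag{$*$}$$ (a) The system is integrable: for every simply connected open $V\subset U$ (for instance a ball, or $U$ itself if $U$ is simply connected), every $x^0\in V$ and every $L^0\in O(n)$ there is a smooth solution $L:V\to O(n)$ of $(*)$ with $L(x^0)=L^0$; the fields $v_i=\sum_{j} L_{ij}e_j$ then form a smooth orthonormal frame on $V$. (b) The solution is unique: if $V\subset U$ is open and connected and $x^0\in V$, two differentiable solutions of $(*)$ on $V$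 that agree at $x^0$ agree on $V$. (c) For every differentiable solution $L$ of $(*)$ on an open set $V\subset U$, the 1-form $\sum_{k=1}^n L_{1k}\,\omega_k$ is closed on $V$. -/

import Mathlib

open scoped ContDiff Matrix

noncomputable section

namespace RiemannianChart

/-- `ℝⁿ`; a vector or a point `x` has the coordinates `x i`. -/
abbrev E (n : ℕ) : Type := EuclideanSpace ℝ (Fin n)

/-- Partial derivative `∂f/∂x_i` of a real function. -/
def partialDeriv {n : ℕ} (i : Fin n) (f : E n → ℝ) (x : E n) : ℝ :=
  fderiv ℝ f x (EuclideanSpace.single i 1)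

/-- `g = (g_ij)` is a smooth Riemannian metric on `U ⊆ ℝⁿ`. (Over `ℝ`, `Matrix.PosDef`
includes symmetry.) -/
structure IsMetricOn {n : ℕ} (g : E n → Matrix (Fin n) (Fin n) ℝ) (U : Set (E n)) : Prop where
  smooth : ∀ i j, ContDiffOn ℝ ∞ (fun x => g x i j) U
  posDef : ∀ x ∈ U, (g x).PosDef

/-- `⟨X, Y⟩ = ∑ g_ij X_i Y_j` at the point `x`. -/
def metricInner {n : ℕ} (g : E n → Matrix (Fin n) (Fin n) ℝ) (x X Y : E n) : ℝ :=
  ∑ i, ∑ j, g x i j * X i * Y j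

/-- Christoffel symbols `Γ^k_ij` of the Levi-Civita connection of `g`. -/
def christoffel {n : ℕ} (g : E n → Matrix (Fin n) (Fin n) ℝ) (k i j : Fin n) (x : E n) : ℝ :=
  (1 / 2) * ∑ l, (g x)⁻¹ k l *
    (partialDeriv i (fun y => g y j l) x + partialDeriv j (fun y => g y i l) x
      - partialDeriv l (fun y => g y i j) x)

/-- The Levi-Civita covariant derivative `∇_X Y` at `x` of a vector field `Y` in the direction of
a tangent vector `X`. -/
def covDeriv {n : ℕ} (g : E n → Matrix (Fin n) (Fin n) ℝ) (Y : E n → E n) (x X : E n) : E n :=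
  WithLp.toLp 2 fun k => fderiv ℝ (fun y => Y y k) x X
    + ∑ i, ∑ j, christoffel g k i j x * X i * Y x j

/-- Components of the curvature tensor `R(X, Y) = [∇_X, ∇_Y] - ∇_[X, Y]`:
`R(∂_a, ∂_b) ∂_c = ∑_d (riemannComp g d c a b) ∂_d`. -/
def riemannComp {n : ℕ} (g : E n → Matrix (Fin n) (Fin n) ℝ) (d c a b : Fin n) (x : E n) : ℝ :=
  partialDeriv a (christoffel g d b c) x - partialDeriv b (christoffel g d a c) x
    + ∑ m, (christoffel g d a m x * christoffel g m b c x
      - christoffel g d b m x * christoffel g m a c x)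

/-- The vector `R(X, Y) Z` at `x`. -/
def riemann {n : ℕ} (g : E n → Matrix (Fin n) (Fin n) ℝ) (x X Y Z : E n) : E n :=
  WithLp.toLp 2 fun d => ∑ a, ∑ b, ∑ c, riemannComp g d c a b x * X a * Y b * Z c

/-- Sectional curvature at `x` of the plane spanned by the independent vectors `X`, `Y`. -/
def sectionalCurvature {n : ℕ} (g : E n → Matrix (Fin n) (Fin n) ℝ) (x X Y : E n) : ℝ :=
  metricInner g x (riemann g x X Y Y) X /
    (metricInner g x X X * metricInner g x Y Y - metricInner g x X Y ^ 2)

/-- All sectional curvatures of `g` at all points of `U` are equal to `K`. -/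
def HasConstSectionalCurvature {n : ℕ} (g : E n → Matrix (Fin n) (Fin n) ℝ) (U : Set (E n))
    (K : ℝ) : Prop :=
  ∀ x ∈ U, ∀ X Y : E n, LinearIndependent ℝ ![X, Y] → sectionalCurvature g x X Y = K

/-- `e_1, …, e_n` is a smooth orthonormal frame field on `U` for the metric `g`. -/
structure IsOrthonormalFrame {n : ℕ} (g : E n → Matrix (Fin n) (Fin n) ℝ) (U : Set (E n))
    (e : Fin n → E n → E n) : Prop where
  smooth : ∀ i, ContDiffOn ℝ ∞ (e i) U
  orthonormal : ∀ x ∈ U, ∀ i j, metricInner g x (e i x) (e j x) = if i = j then 1 else 0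

/-- The dual form `ω_i = ⟨e_i, ·⟩` of an orthonormal frame. -/
def dualForm {n : ℕ} (g : E n → Matrix (Fin n) (Fin n) ℝ) (e : Fin n → E n → E n) (i : Fin n)
    (x : E n) : E n →L[ℝ] ℝ :=
  ∑ b, (∑ a, g x a b * e i x a) • EuclideanSpace.proj b

/-- The forms `ω_i` are the dual coframe: `ω_i(e_j) = δ_ij`. -/
theorem dualForm_frame {n : ℕ} {g : E n → Matrix (Fin n) (Fin n) ℝ} {U : Set (E n)}
    {e : Fin n → E n → E n} (he : IsOrthonormalFrame g U e) {x : E n} (hx : x ∈ U)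
    (i j : Fin n) : dualForm g e i x (e j x) = if i = j then 1 else 0 := by
  rw [← he.orthonormal x hx i j]
  simp only [dualForm, metricInner, sum_apply, smul_apply,
    PiLp.proj_apply, smul_eq_mul, Finset.sum_mul]
  exact Finset.sum_comm

/-- The matrix `W = (ω_ij)` of connection forms of the frame, evaluated at the tangent vector `X`:
`ω_ij(X) = ⟨∇_X e_i, e_j⟩`. -/
def connectionMatrix {n : ℕ} (g : E n → Matrix (Fin n) (Fin n) ℝ) (e : Fin n → E n → E n)
    (x X : E n) : Matrix (Fin n) (Fin n) ℝ :=
  Matrix.of fun i j => metricInner g x (covDeriv g (e i) x X) (e j x)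

/-- The entrywise differential `dL` of a matrix-valued function, evaluated at `X`. -/
def matrixDiff {n : ℕ} (L : E n → Matrix (Fin n) (Fin n) ℝ) (x X : E n) :
    Matrix (Fin n) (Fin n) ℝ :=
  Matrix.of fun i j => fderiv ℝ (fun y => L y i j) x X

/-- `L : V → O(n)` is a (differentiable) solution on the open set `V` of the system
`(dL Lᵗ)_1i + (L W Lᵗ)_1i + ∑_k L_ik ω_k = 0` for `i ≥ 2`, and
`(dL Lᵗ)_ij + (L W Lᵗ)_ij = 0` for `i, j ≥ 2`, `i ≠ j`.
The index `1` of the system is `0 : Fin n` here. -/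
structure IsSolutionOn {n : ℕ} [NeZero n] (g : E n → Matrix (Fin n) (Fin n) ℝ)
    (e : Fin n → E n → E n) (V : Set (E n)) (L : E n → Matrix (Fin n) (Fin n) ℝ) : Prop where
  differentiable : ∀ i j, DifferentiableOn ℝ (fun x => L x i j) V
  orthogonal : ∀ x ∈ V, L x ∈ Matrix.orthogonalGroup (Fin n) ℝ
  eq_first : ∀ x ∈ V, ∀ X : E n, ∀ i : Fin n, i ≠ 0 →
    (matrixDiff L x X * (L x)ᵀ) 0 i + (L x * connectionMatrix g e x X * (L x)ᵀ) 0 i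
      + ∑ k, L x i k * dualForm g e k x X = 0
  eq_rest : ∀ x ∈ V, ∀ X : E n, ∀ i j : Fin n, i ≠ 0 → j ≠ 0 → i ≠ j →
    (matrixDiff L x X * (L x)ᵀ) i j + (L x * connectionMatrix g e x X * (L x)ᵀ) i j = 0

/-- A differential 1-form on the open set `V` that is differentiable and closed. -/
def IsClosedFormOn {n : ℕ} (θ : E n → E n →L[ℝ] ℝ) (V : Set (E n)) : Prop :=
  DifferentiableOn ℝ θ V ∧
    ∀ x ∈ V, extDeriv (fun y => ContinuousAlternatingMap.ofSubsingleton ℝ (E n) ℝ (0 : Fin 1) (θ y))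
      x = 0

end RiemannianChart

end

/-! ### Radial integration of one-forms and a Gronwall vanishing principle -/

section LinearSystems

open MeasureTheory Metric Filter Topology

variable {E F : Type*} [NormedAddCommGroup E] [NormedSpace ℝ E]
  [NormedAddCommGroup F] [NormedSpace ℝ F]

/-! Existence comes from replacing the nonlinear system for `L` by a linear one. In the hyperboloid
model, linear functions on Minkowski space restrict to solutions of Hess u = u g. In curvature -1
the corresponding first-order system du = p, ∇p = u g is flat (`isFlatOn_hessianSystem`), because
R(X, Y)Z = ⟨X, Z⟩Y - ⟨Y, Z⟩X. A Frobenius theorem for linear systems (`IsFlatOn.exists_solution`)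
therefore gives, on simply connected sets, solutions with any prescribed value and gradient at a
point. For two solutions u, w the Lorentz product ⟨grad u, grad w⟩ - u w is constant.

Take solutions s_i, with indices starting at 0, whose Lorentz Gram matrix is diag(0, 1, ..., 1).
Since s_0 is null, |grad s_0| = |s_0|, so s_0 cannot vanish once it is nonzero at one point. The
rows of `L` are then -grad log |s_0| and s_0 grad(s_i / s_0) for i ≠ 0: the unit frame of upper
half-space coordinates, with horospheres as level sets of s_0. Suitable initial gradients give any
prescribed orthogonal matrix at the base point (`exists_isSolutionOn`).

For uniqueness, dL Lᵗ + L W Lᵗ is skew, so the system determines all of its entries and hence dL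
itself: dL_ik = -(LW)_ik + L_0k ∑_j L_ij ω_j - δ_i0 ω_k (`eq_normal_form_of_system`). The difference
of two solutions then has derivative locally bounded by a multiple of its norm, and
`eqOn_zero_of_norm_fderiv_le` applies. The same formula shows that θ = ∑ L_0k ω_k satisfies ∇θ = θ ⊗
θ - g, which is symmetric; as the connection has no torsion, θ is closed.

The Frobenius theorem is proved locally by Picard iteration along rays, where flatness keeps the
exterior derivatives of the iterates small. It is globalised by viewing local solutions as a
covering space of the domain. -/

theorem lineMap_mem_ball {c y : E} {r t : ℝ} (hy : y ∈ ball c r) (ht : t ∈ Set.Icc (0 : ℝ) 1) :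
    c + t • (y - c) ∈ ball c r := by
  rw [mem_ball, dist_eq_norm] at *
  rw [add_sub_cancel_left, norm_smul, Real.norm_of_nonneg ht.1]
  exact (mul_le_of_le_one_left (norm_nonneg _) ht.2).trans_lt hy

/-- The radial homotopy operator of the Poincaré lemma on 1-forms, with base point `c`. -/
noncomputable def radialIntegral (c : E) (β : E → E →L[ℝ] F) (y : E) : F :=
  ∫ t in (0 : ℝ)..1, β (c + t • (y - c)) (y - c)

theorem continuous_ray (c y : E) : Continuous fun t : ℝ => c + t • (y - c) := by fun_prop

theorem continuousOn_radial_integrand {c : E} {r : ℝ} {β : E → E →L[ℝ] F}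
    (hβ : ContinuousOn β (ball c r)) {y : E} (hy : y ∈ ball c r) :
    ContinuousOn (fun t : ℝ => β (c + t • (y - c))) (Set.Icc 0 1) :=
  hβ.comp (continuous_ray c y).continuousOn fun _ ht => lineMap_mem_ball hy ht

/-- The factor `r` makes the Picard map a contraction on small balls. -/
theorem norm_radialIntegral_sub_le {c : E} {r C : ℝ} {β γ : E → E →L[ℝ] F}
    (hβ : ContinuousOn β (ball c r)) (hγ : ContinuousOn γ (ball c r))
    (hC : ∀ y ∈ ball c r, ‖β y - γ y‖ ≤ C) {y : E} (hy : y ∈ ball c r) :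
    ‖radialIntegral c β y - radialIntegral c γ y‖ ≤ C * r := by
  have hr : ‖y - c‖ ≤ r := by rw [← dist_eq_norm]; exact (mem_ball.1 hy).le
  have hint : ∀ δ : E → E →L[ℝ] F, ContinuousOn δ (ball c r) →
      IntervalIntegrable (fun t : ℝ => δ (c + t • (y - c)) (y - c)) volume 0 1 := by
    intro δ hδ
    apply ContinuousOn.intervalIntegrable
    rw [Set.uIcc_of_le zero_le_one]
    exact (continuousOn_radial_integrand hδ hy).clm_apply continuousOn_const
  rw [radialIntegral, radialIntegral, ← intervalIntegral.integral_sub (hint β hβ) (hint γ hγ)]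
  refine (intervalIntegral.norm_integral_le_of_norm_le_const (C := C * r) ?_).trans (by simp)
  intro t ht
  rw [Set.uIoc_of_le zero_le_one] at ht
  have hm := lineMap_mem_ball hy ⟨ht.1.le, ht.2⟩
  rw [← sub_apply]
  exact (ContinuousLinearMap.le_opNorm _ _).trans
    (mul_le_mul (hC _ hm) hr (norm_nonneg _) ((norm_nonneg _).trans (hC _ hm)))

theorem norm_sub_le_of_mem_ball {M : Type*} [SeminormedAddCommGroup M] {c y : M} {r : ℝ}
    (hy : y ∈ ball c r) : ‖y - c‖ ≤ r := by
  rw [← dist_eq_norm]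
  exact (mem_ball.1 hy).le

theorem exists_norm_le_of_norm_fderiv_le {c : E} {r M : ℝ} {f : E → F}
    (hf : ∀ y ∈ ball c r, DifferentiableAt ℝ f y) (hM : ∀ y ∈ ball c r, ‖fderiv ℝ f y‖ ≤ M) :
    ∃ B, ∀ y ∈ ball c r, ‖f y‖ ≤ B := by
  refine ⟨‖f c‖ + M * r, fun x hx => ?_⟩
  have h := (convex_ball c r).norm_image_sub_le_of_norm_fderiv_le hf hM
    (mem_ball_self (pos_of_mem_ball hx)) hx
  have hM0 : 0 ≤ M := (norm_nonneg (fderiv ℝ f x)).trans (hM x hx)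
  calc ‖f x‖ = ‖f c + (f x - f c)‖ := by abel_nf
    _ ≤ ‖f c‖ + ‖f x - f c‖ := norm_add_le _ _
    _ ≤ _ := by
      gcongr
      exact h.trans (by gcongr; exact norm_sub_le_of_mem_ball hx)

/-- Cartan's formula for the radial homotopy operator: if the exterior derivative of `β` is bounded
by `D`, then the derivative of `radialIntegral c β` is `β` up to an error `D * r`. -/
theorem exists_hasFDerivAt_radialIntegral [FiniteDimensional ℝ E] [FiniteDimensional ℝ F]
    {c : E} {r M D : ℝ} {β : E → E →L[ℝ] F} (hD0 : 0 ≤ D)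
    (hβ : ∀ y ∈ ball c r, DifferentiableAt ℝ β y) (hM : ∀ y ∈ ball c r, ‖fderiv ℝ β y‖ ≤ M)
    (hD : ∀ y ∈ ball c r, ∀ w z, ‖fderiv ℝ β y w z - fderiv ℝ β y z w‖ ≤ D * ‖w‖ * ‖z‖)
    {y : E} (hy : y ∈ ball c r) :
    ∃ f' : E →L[ℝ] F, HasFDerivAt (radialIntegral c β) f' y ∧ ‖f' - β y‖ ≤ D * r := by
  borelize E F
  have hr : 0 < r := pos_of_mem_ball hy
  have hcont : ContinuousOn β (ball c r) := fun z hz => (hβ z hz).continuousAt.continuousWithinAt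
  have hM0 : 0 ≤ M := (norm_nonneg (fderiv ℝ β y)).trans (hM y hy)
  obtain ⟨B, hB⟩ := exists_norm_le_of_norm_fderiv_le hβ hM
  -- `G` is the derivative of the integrand in the endpoint. `G₁` is the same expression with the
  -- two arguments of the derivative of `β` exchanged, so that the two differ only by the exterior
  -- derivative of `β`.
  set G : E → ℝ → E →L[ℝ] F := fun x t =>
    β (c + t • (x - c)) + t • (fderiv ℝ β (c + t • (x - c))).flip (x - c) with hG
  set G₁ : ℝ → E →L[ℝ] F := fun t =>
    β (c + t • (y - c)) + t • fderiv ℝ β (c + t • (y - c)) (y - c) with hG₁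
  have hbound : ∀ t ∈ Set.Icc (0 : ℝ) 1, ∀ x ∈ ball c r, ‖G x t‖ ≤ B + M * r := by
    intro t ht x hx
    have hm := lineMap_mem_ball hx ht
    refine (norm_add_le _ _).trans (add_le_add (hB _ hm) ?_)
    rw [norm_smul, Real.norm_of_nonneg ht.1]
    refine (mul_le_of_le_one_left (norm_nonneg _) ht.2).trans ?_
    refine (ContinuousLinearMap.le_opNorm _ _).trans ?_
    rw [ContinuousLinearMap.opNorm_flip]
    exact mul_le_mul (hM _ hm) (norm_sub_le_of_mem_ball hx) (norm_nonneg _) hM0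
  have hbound₁ : ∀ t ∈ Set.Icc (0 : ℝ) 1, ‖G₁ t‖ ≤ B + M * r := by
    intro t ht
    have hm := lineMap_mem_ball hy ht
    refine (norm_add_le _ _).trans (add_le_add (hB _ hm) ?_)
    rw [norm_smul, Real.norm_of_nonneg ht.1]
    refine (mul_le_of_le_one_left (norm_nonneg _) ht.2).trans ?_
    exact (ContinuousLinearMap.le_opNorm _ _).trans
      (mul_le_mul (hM _ hm) (norm_sub_le_of_mem_ball hy) (norm_nonneg _) hM0)
  have hderiv : ∀ t ∈ Set.Icc (0 : ℝ) 1, ∀ x ∈ ball c r,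
      HasFDerivAt (fun x => β (c + t • (x - c)) (x - c)) (G x t) x := by
    intro t ht x hx
    have h1 : HasFDerivAt (fun x : E => x - c) (ContinuousLinearMap.id ℝ E) x :=
      (hasFDerivAt_id x).sub_const c
    have h2 : HasFDerivAt (fun x : E => c + t • (x - c)) (t • ContinuousLinearMap.id ℝ E) x :=
      (h1.const_smul t).const_add c
    have h3 := ((hβ _ (lineMap_mem_ball hx ht)).hasFDerivAt.comp x h2).clm_apply h1
    refine h3.congr_fderiv ?_
    ext w
    simp [hG]
  borelize (E →L[ℝ] E →L[ℝ] F)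
  borelize (E →L[ℝ] F)
  have hβmeas : AEStronglyMeasurable (fun t : ℝ => β (c + t • (y - c)))
      (volume.restrict (Set.uIoc 0 1)) := by
    rw [Set.uIoc_of_le zero_le_one]
    exact ((continuousOn_radial_integrand hcont hy).mono
      Set.Ioc_subset_Icc_self).aestronglyMeasurable measurableSet_Ioc
  -- The derivative of `β` is not assumed continuous; its measurability and boundedness suffice to
  -- integrate it.
  have hdmeas : Measurable fun t : ℝ => fderiv ℝ β (c + t • (y - c)) :=
    (measurable_fderiv ℝ β).comp (continuous_ray c y).measurable
  have hGmeas : AEStronglyMeasurable (G y) (volume.restrict (Set.uIoc 0 1)) := by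
    refine hβmeas.add (Measurable.aestronglyMeasurable ?_)
    have h6 : Continuous fun T : E →L[ℝ] E →L[ℝ] F => T.flip (y - c) :=
      (ContinuousLinearMap.flipₗᵢ ℝ E E F).continuous.clm_apply (continuous_const (y := y - c))
    exact measurable_id.smul (h6.measurable.comp hdmeas)
  have hG₁meas : AEStronglyMeasurable G₁ (volume.restrict (Set.uIoc 0 1)) := by
    refine hβmeas.add (Measurable.aestronglyMeasurable ?_)
    have h6 : Continuous fun T : E →L[ℝ] E →L[ℝ] F => T (y - c) := by fun_prop
    exact measurable_id.smul (h6.measurable.comp hdmeas)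
  have hint : ∀ H : ℝ → E →L[ℝ] F, AEStronglyMeasurable H (volume.restrict (Set.uIoc 0 1)) →
      (∀ t ∈ Set.Icc (0 : ℝ) 1, ‖H t‖ ≤ B + M * r) → IntervalIntegrable H volume 0 1 := by
    intro H hH hHb
    refine IntervalIntegrable.mono_fun' (g := fun _ => B + M * r) (by simp) hH
      ((ae_restrict_iff' measurableSet_uIoc).2 (Eventually.of_forall fun t ht => ?_))
    rw [Set.uIoc_of_le zero_le_one] at ht
    exact hHb t ⟨ht.1.le, ht.2⟩
  have hFcont : ∀ x ∈ ball c r,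
      ContinuousOn (fun t : ℝ => β (c + t • (x - c)) (x - c)) (Set.Icc 0 1) := fun x hx =>
    (continuousOn_radial_integrand hcont hx).clm_apply continuousOn_const
  have hmain := intervalIntegral.hasFDerivAt_integral_of_dominated_of_fderiv_le (μ := volume)
    (a := 0) (b := 1) (F := fun x t => β (c + t • (x - c)) (x - c)) (F' := G) (x₀ := y)
    (bound := fun _ => B + M * r) (isOpen_ball.mem_nhds hy)
    (by
      filter_upwards [isOpen_ball.mem_nhds hy] with x hx
      rw [Set.uIoc_of_le zero_le_one]
      exact ((hFcont x hx).mono Set.Ioc_subset_Icc_self).aestronglyMeasurable measurableSet_Ioc)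
    (by
      apply ContinuousOn.intervalIntegrable
      rw [Set.uIcc_of_le zero_le_one]
      exact hFcont y hy)
    hGmeas
    (Eventually.of_forall fun t ht x hx => by
      rw [Set.uIoc_of_le zero_le_one] at ht
      exact hbound t ⟨ht.1.le, ht.2⟩ x hx)
    (by simp)
    (Eventually.of_forall fun t ht x hx => by
      rw [Set.uIoc_of_le zero_le_one] at ht
      exact hderiv t ⟨ht.1.le, ht.2⟩ x hx)
  refine ⟨_, hmain, ?_⟩
  -- `G₁` is the derivative of t ↦ t β(c + t(y - c)).
  have hftc : ∫ t in (0 : ℝ)..1, G₁ t = β y := by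
    rw [intervalIntegral.integral_eq_sub_of_hasDerivAt
      (f := fun t : ℝ => t • β (c + t • (y - c))) ?_ (hint G₁ hG₁meas hbound₁)]
    · simp
    · intro t ht
      rw [Set.uIcc_of_le zero_le_one] at ht
      have h1 : HasDerivAt (fun t : ℝ => c + t • (y - c)) (y - c) t := by
        simpa using ((hasDerivAt_id t).smul_const (y - c)).const_add c
      have h2 := (hasDerivAt_id t).smul
        ((hβ _ (lineMap_mem_ball hy ht)).hasFDerivAt.comp_hasDerivAt t h1)
      refine h2.congr_deriv ?_
      simp [hG₁, add_comm]
  rw [← hftc, ← intervalIntegral.integral_sub (hint _ hGmeas fun t ht => hbound t ht y hy)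
    (hint G₁ hG₁meas hbound₁)]
  refine (intervalIntegral.norm_integral_le_of_norm_le_const (C := D * r) ?_).trans (by simp)
  intro t ht
  rw [Set.uIoc_of_le zero_le_one] at ht
  have hm := lineMap_mem_ball hy ⟨ht.1.le, ht.2⟩
  have hsub : G y t - G₁ t = t • ((fderiv ℝ β (c + t • (y - c))).flip (y - c)
      - fderiv ℝ β (c + t • (y - c)) (y - c)) := by
    simp only [hG, hG₁, smul_sub]
    abel
  rw [hsub, norm_smul, Real.norm_of_nonneg ht.1.le]
  refine (mul_le_of_le_one_left (norm_nonneg _) ht.2).trans ?_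
  refine ContinuousLinearMap.opNorm_le_bound _ (by positivity) fun w => ?_
  rw [sub_apply, ContinuousLinearMap.flip_apply]
  refine (hD _ hm w (y - c)).trans ?_
  rw [mul_assoc, mul_assoc, mul_comm ‖w‖]
  gcongr
  exact norm_sub_le_of_mem_ball hy

/-- If a function vanishes at a point and its derivative is locally bounded by a multiple of its
norm, then it vanishes. -/
theorem eqOn_zero_of_norm_fderiv_le {V : Set E} (hV : IsOpen V) (hVc : IsPreconnected V)
    {f : E → F} {f' : E → E →L[ℝ] F} (hf : ∀ x ∈ V, HasFDerivAt f (f' x) x)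
    (hb : ∀ x ∈ V, ∃ C : ℝ, ∀ᶠ y in 𝓝 x, ‖f' y‖ ≤ C * ‖f y‖) {x₀ : E} (hx₀ : x₀ ∈ V)
    (h0 : f x₀ = 0) : Set.EqOn f 0 V := by
  have key : ∀ x ∈ V, f x = 0 → ∀ᶠ y in 𝓝 x, f y = 0 := by
    intro x hx hfx
    obtain ⟨C, hC⟩ := hb x hx
    obtain ⟨r, hr, hball⟩ := Metric.eventually_nhds_iff_ball.1 (hC.and (hV.mem_nhds hx))
    filter_upwards [ball_mem_nhds x hr] with y hy
    have hd : ∀ t ∈ Set.Icc (0 : ℝ) 1, HasDerivAt (fun t : ℝ => f (x + t • (y - x)))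
        (f' (x + t • (y - x)) (y - x)) t := by
      intro t ht
      have h1 : HasDerivAt (fun t : ℝ => x + t • (y - x)) (y - x) t := by
        simpa using ((hasDerivAt_id t).smul_const (y - x)).const_add x
      exact (hf _ (hball _ (lineMap_mem_ball hy ht)).2).comp_hasDerivAt t h1
    -- Gronwall's inequality along the segment from `x` to `y`.
    have := eq_zero_of_abs_deriv_le_mul_abs_self_of_eq_zero_right (K := C * ‖y - x‖)
      (fun t ht => (hd t ht).continuousAt.continuousWithinAt)
      (fun t ht => (hd t ⟨ht.1, ht.2.le⟩).hasDerivWithinAt) (by simpa using hfx)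
      (fun t ht => by
        refine (ContinuousLinearMap.le_opNorm _ _).trans ?_
        rw [mul_right_comm]
        gcongr
        exact (hball _ (lineMap_mem_ball hy ⟨ht.1, ht.2.le⟩)).1) 1 (by simp)
    simpa using this
  -- The interior of the zero set is open and, by continuity of `f` and `key`, relatively closed in
  -- `V`; connectedness concludes.
  have hsub : V ⊆ {x | ∀ᶠ y in 𝓝 x, f y = 0} := by
    refine hVc.subset_of_closure_inter_subset isOpen_setOfPred_eventually_nhds
      ⟨x₀, hx₀, key x₀ hx₀ h0⟩ ?_
    rintro x ⟨hxc, hxV⟩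
    refine key x hxV ?_
    have hfr : ∃ᶠ y in 𝓝 x, f y = 0 :=
      (mem_closure_iff_frequently.1 hxc).mono fun y hy => hy.self_of_nhds
    by_contra hne
    obtain ⟨y, hy1, hy2⟩ := (hfr.and_eventually ((hf x hxV).continuousAt.eventually_ne hne)).exists
    exact hy2 hy1
  exact fun x hx => (hsub hx).self_of_nhds

end LinearSystems

/-! ### Local Frobenius theorem for linear systems -/

section LinearSystems

set_option maxSynthPendingDepth 3

open MeasureTheory Metric Filter Topology

variable {E F : Type*} [NormedAddCommGroup E] [NormedSpace ℝ E]
  [NormedAddCommGroup F] [NormedSpace ℝ F]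

/-- The linear system `dΦ = A Φ` is integrable on `V`: the derivative that the system prescribes
for its right hand side is symmetric. -/
def IsFlatOn (A : E → F →L[ℝ] E →L[ℝ] F) (V : Set E) : Prop :=
  ∀ x ∈ V, ∀ v X Y,
    fderiv ℝ A x X v Y + A x (A x v X) Y = fderiv ℝ A x Y v X + A x (A x v Y) X

/-- The Picard iterates, along the rays from `c`, of the linear system `dΦ = A Φ`. -/
noncomputable def picardIterate (A : E → F →L[ℝ] E →L[ℝ] F) (c : E) (v : F) : ℕ → E → F
  | 0 => fun _ => v
  | k + 1 => fun y => v + radialIntegral c (fun x => A x (picardIterate A c v k x)) y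

theorem picardIterate_self (A : E → F →L[ℝ] E →L[ℝ] F) (c : E) (v : F) (k : ℕ) :
    picardIterate A c v k c = v := by
  cases k <;> simp [picardIterate, radialIntegral]

/-- The iterates solve the system up to a defect that must be controlled together with their
increments. By flatness the exterior derivative of AΦ_k involves only the defect of Φ_k, and the
homotopy formula then bounds the defect of Φ_{k+1}. Both quantities halve at each step. -/
theorem picardIterate_estimates [FiniteDimensional ℝ E] [FiniteDimensional ℝ F]
    {A : E → F →L[ℝ] E →L[ℝ] F} {c : E} {r C C' : ℝ} (hC0 : 0 ≤ C) (hCr : C * r ≤ 1 / 8)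
    (hA : ∀ y ∈ ball c r, DifferentiableAt ℝ A y) (hC : ∀ y ∈ ball c r, ‖A y‖ ≤ C)
    (hC' : ∀ y ∈ ball c r, ‖fderiv ℝ A y‖ ≤ C') (hflat : IsFlatOn A (ball c r)) (v : F) (k : ℕ) :
    (∀ y ∈ ball c r, ∃ f' : E →L[ℝ] F, HasFDerivAt (picardIterate A c v k) f' y ∧
      ‖f' - A y (picardIterate A c v k y)‖ ≤ 4 * C * ‖v‖ / 2 ^ k) ∧
    (∀ y ∈ ball c r, ‖picardIterate A c v (k + 1) y - picardIterate A c v k y‖ ≤ ‖v‖ / 2 ^ k) ∧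
    ∃ D, 0 ≤ D ∧ ∀ y ∈ ball c r, ‖picardIterate A c v k y‖ ≤ D := by
  induction k with
  | zero =>
    have hAv : ∀ y ∈ ball c r, ‖A y v‖ ≤ C * ‖v‖ := fun y hy =>
      (A y).le_of_opNorm_le (hC y hy) v
    refine ⟨fun y hy => ⟨0, hasFDerivAt_const v y, ?_⟩, fun y hy => ?_, ‖v‖, norm_nonneg _,
      fun y _ => le_rfl⟩
    · simp only [picardIterate, zero_sub, norm_neg, pow_zero, div_one]
      nlinarith [hAv y hy, norm_nonneg v, mul_nonneg hC0 (norm_nonneg v)]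
    · have h := norm_radialIntegral_sub_le (c := c) (r := r) (C := C * ‖v‖)
        (β := fun x => A x v) (γ := fun _ => 0)
        (fun z hz => ((hA z hz).continuousAt.clm_apply continuousAt_const).continuousWithinAt)
        continuousOn_const (fun z hz => by simpa using hAv z hz) hy
      have h0 : radialIntegral c (fun _ => (0 : E →L[ℝ] F)) y = 0 := by simp [radialIntegral]
      rw [h0, sub_zero] at h
      simp only [picardIterate, add_sub_cancel_left, pow_zero, div_one]
      nlinarith [norm_nonneg v]
  | succ k ih =>
    obtain ⟨ih1, ih2, D, hD0, ih3⟩ := ih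
    set Φ := picardIterate A c v k with hΦ
    set Ψ := picardIterate A c v (k + 1) with hΨ
    have hΨeq : Ψ = fun y => v + radialIntegral c (fun x => A x (Φ x)) y := rfl
    choose! Φ' hΦ' hR using ih1
    set K := 4 * C * ‖v‖ / 2 ^ k with hK
    have hK0 : 0 ≤ K := by positivity
    set β : E → E →L[ℝ] F := fun x => A x (Φ x) with hβ
    have hβd : ∀ y ∈ ball c r, HasFDerivAt β
        ((A y).comp (Φ' y) + (fderiv ℝ A y).flip (Φ y)) y := fun y hy =>
      (hA y hy).hasFDerivAt.clm_apply (hΦ' y hy)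
    have hΦ'b : ∀ y ∈ ball c r, ‖Φ' y‖ ≤ K + C * D := fun y hy => by
      calc ‖Φ' y‖ = ‖(Φ' y - A y (Φ y)) + A y (Φ y)‖ := by rw [sub_add_cancel]
        _ ≤ ‖Φ' y - A y (Φ y)‖ + ‖A y (Φ y)‖ := norm_add_le _ _
        _ ≤ K + C * D := add_le_add (hR y hy)
          ((A y).le_of_opNorm_le_of_le (hC y hy) (ih3 y hy))
    have hβb : ∀ y ∈ ball c r, ‖fderiv ℝ β y‖ ≤ C * (K + C * D) + C' * D := fun y hy => by
      rw [(hβd y hy).fderiv]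
      refine (norm_add_le _ _).trans (add_le_add ?_ ?_)
      · exact (ContinuousLinearMap.opNorm_comp_le _ _).trans
          (mul_le_mul (hC y hy) (hΦ'b y hy) (norm_nonneg _) hC0)
      · refine ContinuousLinearMap.le_of_opNorm_le_of_le _ ?_ (ih3 y hy)
        rw [ContinuousLinearMap.opNorm_flip]
        exact hC' y hy
    have hcurl : ∀ y ∈ ball c r, ∀ w z,
        ‖fderiv ℝ β y w z - fderiv ℝ β y z w‖ ≤ (2 * C * K) * ‖w‖ * ‖z‖ := fun y hy w z => by
      rw [(hβd y hy).fderiv]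
      have hA2 : ∀ w z : E, ‖A y ((Φ' y - A y (Φ y)) w) z‖ ≤ C * K * ‖w‖ * ‖z‖ := fun w z => by
        refine ContinuousLinearMap.le_of_opNorm_le _ ?_ z
        rw [mul_assoc]
        exact (A y).le_of_opNorm_le_of_le (hC y hy)
          (ContinuousLinearMap.le_of_opNorm_le _ (hR y hy) w)
      -- Writing Φ' = AΦ + defect, flatness cancels everything except the defect.
      have heq : ((A y).comp (Φ' y) + (fderiv ℝ A y).flip (Φ y)) w z
          - ((A y).comp (Φ' y) + (fderiv ℝ A y).flip (Φ y)) z w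
          = A y ((Φ' y - A y (Φ y)) w) z - A y ((Φ' y - A y (Φ y)) z) w := by
        have h := hflat y hy (Φ y) w z
        simp only [add_apply, ContinuousLinearMap.comp_apply,
          ContinuousLinearMap.flip_apply, sub_apply, map_sub]
        rw [← sub_eq_zero] at h ⊢
        rw [← h]
        abel
      rw [heq]
      refine (norm_sub_le _ _).trans ?_
      have h1 := hA2 w z
      have h2 := hA2 z w
      nlinarith
    have hstep : ∀ y ∈ ball c r, ‖Ψ y - Φ y‖ ≤ ‖v‖ / 2 ^ k := ih2
    have hcontβ : ContinuousOn β (ball c r) := fun y hy =>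
      (hβd y hy).continuousAt.continuousWithinAt
    have hΨd : ∀ y ∈ ball c r, ∃ f' : E →L[ℝ] F, HasFDerivAt Ψ f' y ∧
        ‖f' - A y (Φ y)‖ ≤ 2 * C * K * r := fun y hy => by
      obtain ⟨f', h1, h2⟩ := exists_hasFDerivAt_radialIntegral (c := c) (r := r) (β := β)
        (D := 2 * C * K) (by positivity) (fun y hy => (hβd y hy).differentiableAt) hβb hcurl hy
      exact ⟨f', h1.const_add v, h2⟩
    have hAdiff : ∀ y ∈ ball c r, ‖A y (Ψ y) - A y (Φ y)‖ ≤ C * (‖v‖ / 2 ^ k) := fun y hy => by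
      rw [← map_sub]
      exact (A y).le_of_opNorm_le_of_le (hC y hy) (hstep y hy)
    refine ⟨fun y hy => ?_, fun y hy => ?_, D + ‖v‖ / 2 ^ k, by positivity, fun y hy => ?_⟩
    · obtain ⟨f', h1, h2⟩ := hΨd y hy
      refine ⟨f', h1, ?_⟩
      calc ‖f' - A y (Ψ y)‖ = ‖(f' - A y (Φ y)) - (A y (Ψ y) - A y (Φ y))‖ := by
            congr 1; abel
        _ ≤ ‖f' - A y (Φ y)‖ + ‖A y (Ψ y) - A y (Φ y)‖ := norm_sub_le _ _
        _ ≤ 2 * C * K * r + C * (‖v‖ / 2 ^ k) := add_le_add h2 (hAdiff y hy)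
        -- The first quarter uses C r ≤ 1/8; the second is the equality C‖v‖ / 2^k = K / 4, which
        -- explains the factor 4 in `K`.
        _ ≤ K / 4 + K / 4 := by
          gcongr
          · nlinarith
          · rw [hK]; apply le_of_eq; ring
        _ = 4 * C * ‖v‖ / 2 ^ (k + 1) := by rw [hK, pow_succ]; ring
    · have hcΨ : ContinuousOn (fun x => A x (Ψ x)) (ball c r) := fun y hy => by
        obtain ⟨f', h1, _⟩ := hΨd y hy
        exact ((hA y hy).continuousAt.clm_apply h1.continuousAt).continuousWithinAt
      have h := norm_radialIntegral_sub_le hcΨ hcontβ hAdiff hy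
      have heq : picardIterate A c v (k + 1 + 1) y - Ψ y
          = radialIntegral c (fun x => A x (Ψ x)) y - radialIntegral c β y := by
        rw [hΨeq]
        simp only [picardIterate]
        exact add_sub_add_left_eq_sub _ _ _
      rw [heq]
      refine h.trans ?_
      have h0 : 0 ≤ ‖v‖ / 2 ^ k := by positivity
      have h1 : ‖v‖ / 2 ^ (k + 1) = ‖v‖ / 2 ^ k / 2 := by rw [pow_succ]; ring
      rw [h1]
      nlinarith
    · calc ‖Ψ y‖ = ‖Φ y + (Ψ y - Φ y)‖ := by abel_nf
        _ ≤ _ := (norm_add_le _ _).trans (add_le_add (ih3 y hy) (hstep y hy))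

/-- The Picard iterates converge geometrically and their derivatives converge uniformly to A applied
to the limit, so the limit may be differentiated termwise. -/
theorem exists_hasFDerivAt_of_bounds [FiniteDimensional ℝ E] [FiniteDimensional ℝ F]
    {A : E → F →L[ℝ] E →L[ℝ] F} {c : E} {r C C' : ℝ} (hC0 : 0 ≤ C) (hCr : C * r ≤ 1 / 8)
    (hA : ∀ y ∈ ball c r, DifferentiableAt ℝ A y) (hC : ∀ y ∈ ball c r, ‖A y‖ ≤ C)
    (hC' : ∀ y ∈ ball c r, ‖fderiv ℝ A y‖ ≤ C') (hr : 0 < r)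
    (hflat : IsFlatOn A (ball c r)) (v : F) :
    ∃ Φ : E → F, Φ c = v ∧ ∀ y ∈ ball c r, HasFDerivAt Φ (A y (Φ y)) y := by
  have hest := picardIterate_estimates hC0 hCr hA hC hC' hflat v
  set Φ := picardIterate A c v with hΦ
  have : CompleteSpace F := FiniteDimensional.complete ℝ F
  have hdist : ∀ y ∈ ball c r, ∀ k, dist (Φ k y) (Φ (k + 1) y) ≤ 2 * ‖v‖ / 2 / 2 ^ k :=
    fun y hy k => by
      rw [dist_comm, dist_eq_norm, mul_div_cancel_left₀ _ two_ne_zero]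
      exact (hest k).2.1 y hy
  have hlim : ∀ y ∈ ball c r, ∃ z, Tendsto (fun k => Φ k y) atTop (𝓝 z) := fun y hy =>
    cauchySeq_tendsto_of_complete (cauchySeq_of_le_geometric_two (hdist y hy))
  choose! L hL using hlim
  choose! Φ' hΦ' hR using fun k => (hest k).1
  refine ⟨L, ?_, fun y hy => ?_⟩
  · have := hL c (mem_ball_self hr)
    simp only [hΦ, picardIterate_self] at this
    exact tendsto_nhds_unique this tendsto_const_nhds
  · refine hasFDerivAt_of_tendstoUniformlyOn (f := Φ) (f' := Φ') (l := atTop)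
      (g' := fun y => A y (L y)) isOpen_ball ?_ hΦ' hL hy
    rw [Metric.tendstoUniformlyOn_iff]
    intro ε hε
    have ht : Tendsto (fun k : ℕ => 6 * C * ‖v‖ * (1 / 2 : ℝ) ^ k) atTop (𝓝 (6 * C * ‖v‖ * 0)) :=
      (tendsto_pow_atTop_nhds_zero_of_lt_one (by norm_num) (by norm_num)).const_mul _
    rw [mul_zero] at ht
    filter_upwards [ht.eventually (gt_mem_nhds hε)] with k hk z hz
    refine lt_of_le_of_lt ?_ hk
    rw [dist_comm, dist_eq_norm]
    have h1 : ‖A z (Φ k z) - A z (L z)‖ ≤ C * (2 * ‖v‖ / 2 ^ k) := by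
      rw [← map_sub]
      refine (A z).le_of_opNorm_le_of_le (hC z hz) ?_
      rw [← dist_eq_norm]
      exact dist_le_of_le_geometric_two_of_tendsto (hdist z hz) (hL z hz) k
    calc ‖Φ' k z - A z (L z)‖
        = ‖(Φ' k z - A z (Φ k z)) + (A z (Φ k z) - A z (L z))‖ := by rw [sub_add_sub_cancel]
      _ ≤ _ := (norm_add_le _ _).trans (add_le_add (hR k z hz) h1)
      _ = _ := by rw [one_div, inv_pow]; ring

/-- Frobenius theorem for linear systems, local version: on a small ball, there is a solution with
any prescribed value at the centre. -/
theorem IsFlatOn.exists_local_solution [FiniteDimensional ℝ E] [FiniteDimensional ℝ F]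
    {A : E → F →L[ℝ] E →L[ℝ] F} {V : Set E} (hflat : IsFlatOn A V) (hV : IsOpen V)
    (hA : ContDiffOn ℝ 1 A V) {c : E} (hc : c ∈ V) :
    ∃ r > 0, ball c r ⊆ V ∧ ∀ v : F, ∃ Φ : E → F, Φ c = v ∧
      ∀ y ∈ ball c r, HasFDerivAt Φ (A y (Φ y)) y := by
  have hd : ∀ y ∈ V, DifferentiableAt ℝ A y := fun y hy =>
    (hA.differentiableOn one_ne_zero).differentiableAt (hV.mem_nhds hy)
  have hc' : ContinuousAt (fderiv ℝ A) c :=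
    (hA.continuousOn_fderiv_of_isOpen hV le_rfl).continuousAt (hV.mem_nhds hc)
  have h1 := (hd c hc).continuousAt.norm.eventually (gt_mem_nhds (lt_add_one ‖A c‖))
  have h2 := hc'.norm.eventually (gt_mem_nhds (lt_add_one ‖fderiv ℝ A c‖))
  obtain ⟨r, hr, hball⟩ := Metric.eventually_nhds_iff_ball.1 ((h1.and h2).and (hV.mem_nhds hc))
  set C := ‖A c‖ + 1 with hC
  have hCpos : 0 < C := by positivity
  -- The radius is cut down to reach the smallness C r ≤ 1/8 required by the iteration.
  have hs : min r (1 / (8 * C)) ≤ r := min_le_left _ _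
  have hsub : ball c (min r (1 / (8 * C))) ⊆ ball c r := ball_subset_ball hs
  refine ⟨min r (1 / (8 * C)), by positivity, fun y hy => (hball y (hsub hy)).2, fun v => ?_⟩
  refine exists_hasFDerivAt_of_bounds (C := C) (C' := ‖fderiv ℝ A c‖ + 1) hCpos.le ?_
    (fun y hy => hd y (hball y (hsub hy)).2) (fun y hy => (hball y (hsub hy)).1.1.le)
    (fun y hy => (hball y (hsub hy)).1.2.le) (by positivity)
    (fun y hy => hflat y (hball y (hsub hy)).2) v
  calc C * min r (1 / (8 * C)) ≤ C * (1 / (8 * C)) := by gcongr; exact min_le_right _ _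
    _ = 1 / 8 := by field_simp

end LinearSystems

/-! ### Global sections by covering space theory -/

section Monodromy

open Filter Topology Bundle

/-- A locally constant family of trivialisations `T i x : F ≃ F`, `x ∈ B i`, on a simply connected
space has a global section with any prescribed value. -/
theorem exists_section_of_locally_constant_trivializations {X F : Type*} [TopologicalSpace X]
    [SimplyConnectedSpace X] [LocallyPathConnectedSpace X] (B : X → Set X)
    (hBo : ∀ i, IsOpen (B i)) (hB : ∀ i, i ∈ B i) (T : X → X → F ≃ F)
    (hT : ∀ i j v, ∀ x ∈ B i ∩ B j,
      ∀ᶠ y in 𝓝 x, (T j y).symm (T i y v) = (T j x).symm (T i x v))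
    (x₀ : X) (w : F) :
    ∃ s : X → F, s x₀ = w ∧ ∀ x, ∃ v, ∀ᶠ y in 𝓝 x, s y = T x y v := by
  -- With a discrete fibre, locally constant transition maps are continuous and the bundle is a
  -- covering of `X`.
  let _ : TopologicalSpace F := ⊥
  have : DiscreteTopology F := ⟨rfl⟩
  let Z : FiberBundleCore X X F :=
    { baseSet := B
      isOpen_baseSet := hBo
      indexAt := id
      mem_baseSet_at := hB
      coordChange := fun i j x v => (T j x).symm (T i x v)
      coordChange_self := fun i x _ v => by simp
      continuousOn_coordChange := fun i j => by
        rintro ⟨x, v⟩ ⟨hx, -⟩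
        refine ContinuousAt.continuousWithinAt ?_
        refine tendsto_nhds_of_eventually_eq ?_
        rw [nhds_prod_eq, nhds_discrete F, prod_pure, eventually_map]
        exact hT i j v x hx
      coordChange_comp := fun i j k x _ v => by simp }
  have hcov : IsCoveringMap (π F Z.Fiber) := FiberBundle.isCoveringMap
  -- Simple connectedness lifts the identity of `X`, which is a global section.
  obtain ⟨S, ⟨hS0, hS⟩, -⟩ := hcov.existsUnique_continuousMap_lifts (ContinuousMap.id X) x₀
    (⟨x₀, (T x₀ x₀).symm w⟩ : TotalSpace F Z.Fiber) rfl
  have hproj : ∀ x, (S x).proj = x := fun x => congrFun hS x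
  refine ⟨fun x => T (S x).proj (S x).proj (S x).snd, ?_, fun x => ?_⟩
  · exact (congrArg (fun z : TotalSpace F Z.Fiber => T z.proj z.proj z.2) hS0).trans
      (Equiv.apply_symm_apply _ _)
  · have hmem : S x ∈ (Z.localTriv x).source := by
      rw [Z.mem_localTriv_source, hproj]
      exact hB x
    have hc : ContinuousAt (fun y => (Z.localTriv x (S y)).2) x :=
      (((Z.localTriv x).continuousOn.continuousAt
        ((Z.localTriv x).open_source.mem_nhds hmem)).comp S.continuous.continuousAt).snd
    refine ⟨(Z.localTriv x (S x)).2, ?_⟩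
    have hev := hc.eventually (IsOpen.mem_nhds (isOpen_discrete {(Z.localTriv x (S x)).2}) rfl)
    filter_upwards [hev] with y hy
    rw [← Set.mem_singleton_iff.1 hy, Z.localTriv_apply]
    show _ = T x y ((T x (S y).proj).symm (T (S y).proj (S y).proj (S y).2))
    rw [hproj y, Equiv.apply_symm_apply]

end Monodromy

/-! ### Global Frobenius theorem, uniqueness and smoothness for linear systems -/

section LinearSystems

set_option maxSynthPendingDepth 3

open MeasureTheory Metric Filter Topology

variable {E F : Type*} [NormedAddCommGroup E] [NormedSpace ℝ E]
  [NormedAddCommGroup F] [NormedSpace ℝ F]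

/-- Uniqueness for the linear system `dΦ = A Φ`. -/
theorem eqOn_of_hasFDerivAt_linear {A : E → F →L[ℝ] E →L[ℝ] F} {V : Set E} (hV : IsOpen V)
    (hVc : IsPreconnected V) (hA : ContinuousOn A V) {Φ Ψ : E → F}
    (hΦ : ∀ y ∈ V, HasFDerivAt Φ (A y (Φ y)) y) (hΨ : ∀ y ∈ V, HasFDerivAt Ψ (A y (Ψ y)) y)
    {x₀ : E} (hx₀ : x₀ ∈ V) (h0 : Φ x₀ = Ψ x₀) : Set.EqOn Φ Ψ V := by
  have h := eqOn_zero_of_norm_fderiv_le hV hVc (f := fun y => Φ y - Ψ y)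
    (f' := fun y => A y (Φ y - Ψ y)) (fun y hy => by
      rw [map_sub]
      exact (hΦ y hy).sub (hΨ y hy))
    (fun x hx => by
      have h1 := (hA.continuousAt (hV.mem_nhds hx)).norm.eventually
        (gt_mem_nhds (lt_add_one ‖A x‖))
      exact ⟨‖A x‖ + 1, h1.mono fun y hy => (A y).le_of_opNorm_le hy.le _⟩)
    hx₀ (sub_eq_zero.2 h0)
  exact fun y hy => sub_eq_zero.1 (h hy)

/-- Frobenius theorem for linear systems on simply connected open sets. -/
theorem IsFlatOn.exists_solution [FiniteDimensional ℝ E] [FiniteDimensional ℝ F]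
    {A : E → F →L[ℝ] E →L[ℝ] F} {V : Set E} (hflat : IsFlatOn A V) (hV : IsOpen V)
    (hVs : IsSimplyConnected V) (hA : ContDiffOn ℝ 1 A V) {x₀ : E} (hx₀ : x₀ ∈ V) (w : F) :
    ∃ Φ : E → F, Φ x₀ = w ∧ ∀ y ∈ V, HasFDerivAt Φ (A y (Φ y)) y := by
  classical
  choose! r hr hball hsol using fun c (hc : c ∈ V) => hflat.exists_local_solution hV hA hc
  choose! S hS0 hS using hsol
  have hcontb : ∀ c ∈ V, ContinuousOn A (ball c (r c)) := fun c hc =>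
    hA.continuousOn.mono (hball c hc)
  have hadd : ∀ c ∈ V, ∀ y ∈ ball c (r c), ∀ v v' : F, S c (v + v') y = S c v y + S c v' y :=
    fun c hc y hy v v' => eqOn_of_hasFDerivAt_linear isOpen_ball (convex_ball c (r c)).isPreconnected
      (hcontb c hc) (Ψ := fun y => S c v y + S c v' y) (hS c hc (v + v')) (fun z hz => by
        rw [map_add]
        exact (hS c hc v z hz).add (hS c hc v' z hz)) (mem_ball_self (hr c hc))
      (by simp [hS0 c hc]) hy
  have hsmul : ∀ c ∈ V, ∀ y ∈ ball c (r c), ∀ (a : ℝ) (v : F), S c (a • v) y = a • S c v y :=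
    fun c hc y hy a v => eqOn_of_hasFDerivAt_linear isOpen_ball (convex_ball c (r c)).isPreconnected
      (hcontb c hc) (Ψ := fun y => a • S c v y) (hS c hc (a • v)) (fun z hz => by
        rw [map_smul]
        exact (hS c hc v z hz).const_smul a) (mem_ball_self (hr c hc))
      (by simp [hS0 c hc]) hy
  have hbij : ∀ c ∈ V, ∀ y ∈ ball c (r c), Function.Bijective fun v : F => S c v y := by
    intro c hc y hy
    let T : F →ₗ[ℝ] F :=
      { toFun := fun v => S c v y
        map_add' := hadd c hc y hy
        map_smul' := hsmul c hc y hy }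
    -- Uniqueness is applied from `y` back to the centre; surjectivity is then a matter of
    -- dimension.
    have hinj : Function.Injective T := fun v v' hvv => by
      have h := eqOn_of_hasFDerivAt_linear isOpen_ball (convex_ball c (r c)).isPreconnected
        (hcontb c hc) (hS c hc v) (hS c hc v') hy hvv (mem_ball_self (hr c hc))
      rwa [hS0 c hc, hS0 c hc] at h
    exact ⟨hinj, LinearMap.injective_iff_surjective.1 hinj⟩
  have : SimplyConnectedSpace V := hVs.simplyConnectedSpace
  have : LocallyPathConnectedSpace V := hV.locallyPathConnectedSpace
  let T : V → V → F ≃ F := fun i x =>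
    if h : (x : E) ∈ ball (i : E) (r i) then Equiv.ofBijective _ (hbij i i.2 x h) else Equiv.refl F
  have hTS : ∀ (i x : V), (x : E) ∈ ball (i : E) (r i) → ∀ v, T i x v = S i v x := by
    intro i x hx v
    simp only [T, dif_pos hx]
    rfl
  obtain ⟨s, hs0, hs⟩ := exists_section_of_locally_constant_trivializations
    (fun i : V => Subtype.val ⁻¹' ball (i : E) (r i))
    (fun i => isOpen_ball.preimage continuous_subtype_val) (fun i => mem_ball_self (hr i i.2)) T
    (by
      rintro i j v x ⟨hxi, hxj⟩
      set u := (T j x).symm (T i x v) with hu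
      have hux : S j u x = S i v x := by
        rw [← hTS j x hxj, ← hTS i x hxi, hu, Equiv.apply_symm_apply]
      -- Intersections of balls are convex, hence connected, so agreement at `x` spreads over the
      -- whole overlap.
      have heq : Set.EqOn (S j u) (S i v) (ball (j : E) (r j) ∩ ball (i : E) (r i)) :=
        eqOn_of_hasFDerivAt_linear (isOpen_ball.inter isOpen_ball)
          ((convex_ball _ _).inter (convex_ball _ _)).isPreconnected
          ((hcontb j j.2).mono Set.inter_subset_left) (fun y hy => hS j j.2 u y hy.1)
          (fun y hy => hS i i.2 v y hy.2) ⟨hxj, hxi⟩ hux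
      have hn : ∀ᶠ y : V in 𝓝 x, (y : E) ∈ ball (j : E) (r j) ∩ ball (i : E) (r i) :=
        continuous_subtype_val.continuousAt.eventually
          ((isOpen_ball.inter isOpen_ball).mem_nhds ⟨hxj, hxi⟩)
      filter_upwards [hn] with y hy
      rw [Equiv.symm_apply_eq, hTS j y hy.1, hTS i y hy.2]
      exact (heq hy).symm)
    ⟨x₀, hx₀⟩ w
  refine ⟨fun x => if h : x ∈ V then s ⟨x, h⟩ else 0, by simp [hx₀, hs0], fun y hy => ?_⟩
  obtain ⟨v, hv⟩ := hs ⟨y, hy⟩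
  rw [nhds_subtype_eq_comap, eventually_comap] at hv
  have hloc : (fun x => if h : x ∈ V then s ⟨x, h⟩ else 0) =ᶠ[𝓝 y] S y v := by
    filter_upwards [hv, hV.mem_nhds hy, ball_mem_nhds y (hr y hy)] with z hz hzV hzb
    rw [dif_pos hzV, hz ⟨z, hzV⟩ rfl]
    exact hTS ⟨y, hy⟩ ⟨z, hzV⟩ hzb v
  have h := hS y hy v y (mem_ball_self (hr y hy))
  rw [← hloc.eq_of_nhds] at h
  exact h.congr_of_eventuallyEq hloc

/-- Solutions of a smooth linear system are smooth. -/
theorem contDiffOn_of_hasFDerivAt_linear {A : E → F →L[ℝ] E →L[ℝ] F} {V : Set E} (hV : IsOpen V)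
    (hA : ContDiffOn ℝ ∞ A V) {Φ : E → F} (hΦ : ∀ y ∈ V, HasFDerivAt Φ (A y (Φ y)) y) :
    ContDiffOn ℝ ∞ Φ V := by
  have hdiff : DifferentiableOn ℝ Φ V := fun y hy =>
    (hΦ y hy).differentiableAt.differentiableWithinAt
  rw [contDiffOn_infty]
  intro k
  induction k with
  | zero => exact contDiffOn_zero.2 hdiff.continuousOn
  | succ k ih =>
    push_cast
    rw [contDiffOn_succ_iff_fderiv_of_isOpen hV]
    refine ⟨hdiff, by simp, ?_⟩
    have h := (hA.of_le (mod_cast le_top : (k : WithTop ℕ∞) ≤ ∞)).clm_apply ih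
    exact h.congr fun y hy => (hΦ y hy).fderiv

end LinearSystems

/-! ### The metric and its Levi-Civita connection in coordinates -/

noncomputable section

namespace RiemannianChart

set_option maxSynthPendingDepth 3

variable {n : ℕ}

theorem eq_sum_single (X : E n) : X = ∑ i, X i • EuclideanSpace.single i (1 : ℝ) := by
  ext j
  simp [Finset.sum_apply, Pi.single_apply]

theorem fderiv_apply_eq_sum (f : E n → ℝ) (x X : E n) :
    fderiv ℝ f x X = ∑ i, partialDeriv i f x * X i := by
  conv_lhs => rw [eq_sum_single X]
  simp [partialDeriv, mul_comm]

theorem contDiffOn_partialDeriv {U : Set (E n)} (hU : IsOpen U) {f : E n → ℝ}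
    (hf : ContDiffOn ℝ ∞ f U) (i : Fin n) : ContDiffOn ℝ ∞ (partialDeriv i f) U :=
  (hf.fderiv_of_isOpen hU (by simp)).clm_apply contDiffOn_const

theorem contDiffOn_det {m : Type*} [Fintype m] [DecidableEq m] {U : Set (E n)}
    {g : E n → Matrix m m ℝ} (hg : ∀ i j, ContDiffOn ℝ ∞ (fun x => g x i j) U) :
    ContDiffOn ℝ ∞ (fun x => (g x).det) U := by
  simp only [Matrix.det_apply]
  exact ContDiffOn.sum fun σ _ => (contDiffOn_prod fun i _ => hg _ _).const_smul _

/-- Cramer's rule: the entries are rational functions of those of `g`. -/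
theorem contDiffOn_matrix_inv {U : Set (E n)} {g : E n → Matrix (Fin n) (Fin n) ℝ}
    (hg : ∀ i j, ContDiffOn ℝ ∞ (fun x => g x i j) U) (h0 : ∀ x ∈ U, (g x).det ≠ 0)
    (k l : Fin n) : ContDiffOn ℝ ∞ (fun x => (g x)⁻¹ k l) U := by
  simp only [Matrix.inv_def, Ring.inverse_eq_inv', Matrix.smul_apply, smul_eq_mul]
  refine ((contDiffOn_det hg).inv h0).mul ?_
  simp only [Matrix.adjugate_apply]
  refine contDiffOn_det fun i j => ?_
  simp only [Matrix.updateRow_apply]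
  split_ifs
  · exact contDiffOn_const
  · exact hg i j

/-- The metric at `x` as a continuous bilinear form. -/
def metricForm (g : E n → Matrix (Fin n) (Fin n) ℝ) (x : E n) : E n →L[ℝ] E n →L[ℝ] ℝ :=
  ∑ i, ∑ j, g x i j • (EuclideanSpace.proj i : E n →L[ℝ] ℝ).smulRight
    (EuclideanSpace.proj j : E n →L[ℝ] ℝ)

theorem metricForm_apply (g : E n → Matrix (Fin n) (Fin n) ℝ) (x X Y : E n) :
    metricForm g x X Y = metricInner g x X Y := by
  simp [metricForm, metricInner, mul_assoc]

/-- The Christoffel symbols at `x` as a continuous bilinear map. -/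
def christoffelForm (g : E n → Matrix (Fin n) (Fin n) ℝ) (x : E n) : E n →L[ℝ] E n →L[ℝ] E n :=
  ∑ k, ∑ i, ∑ j, christoffel g k i j x • (EuclideanSpace.proj i : E n →L[ℝ] ℝ).smulRight
    ((EuclideanSpace.proj j : E n →L[ℝ] ℝ).smulRight (EuclideanSpace.single k (1 : ℝ)))

theorem christoffelForm_apply (g : E n → Matrix (Fin n) (Fin n) ℝ) (x X Y : E n) (k : Fin n) :
    christoffelForm g x X Y k = ∑ i, ∑ j, christoffel g k i j x * X i * Y j := by
  simp [christoffelForm, Finset.sum_apply, Pi.single_apply, mul_assoc]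

variable {g : E n → Matrix (Fin n) (Fin n) ℝ} {U : Set (E n)}

theorem IsMetricOn.contDiffOn_metricForm (hg : IsMetricOn g U) :
    ContDiffOn ℝ ∞ (metricForm g) U :=
  ContDiffOn.sum fun i _ => ContDiffOn.sum fun j _ => (hg.smooth i j).smul contDiffOn_const

theorem IsMetricOn.contDiffOn_christoffel (hg : IsMetricOn g U) (hU : IsOpen U) (k i j : Fin n) :
    ContDiffOn ℝ ∞ (christoffel g k i j) U := by
  refine contDiffOn_const.mul (ContDiffOn.sum fun l _ => ?_)
  refine (contDiffOn_matrix_inv hg.smooth (fun x hx => (hg.posDef x hx).det_pos.ne') k l).mul ?_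
  exact ((contDiffOn_partialDeriv hU (hg.smooth j l) i).add
    (contDiffOn_partialDeriv hU (hg.smooth i l) j)).sub
    (contDiffOn_partialDeriv hU (hg.smooth i j) l)

theorem IsMetricOn.contDiffOn_christoffelForm (hg : IsMetricOn g U) (hU : IsOpen U) :
    ContDiffOn ℝ ∞ (christoffelForm g) U :=
  ContDiffOn.sum fun k _ => ContDiffOn.sum fun i _ => ContDiffOn.sum fun j _ =>
    (hg.contDiffOn_christoffel hU k i j).smul contDiffOn_const

theorem differentiableAt_of_contDiffOn {F : Type*} [NormedAddCommGroup F] [NormedSpace ℝ F]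
    {f : E n → F} (hU : IsOpen U) (hf : ContDiffOn ℝ ∞ f U) {x : E n} (hx : x ∈ U) :
    DifferentiableAt ℝ f x :=
  (hf.contDiffAt (hU.mem_nhds hx)).differentiableAt (by simp)

theorem IsMetricOn.symm (hg : IsMetricOn g U) {x : E n} (hx : x ∈ U) (i j : Fin n) :
    g x i j = g x j i := by
  simpa using (hg.posDef x hx).isHermitian.apply j i

theorem IsMetricOn.metricForm_symm (hg : IsMetricOn g U) {x : E n} (hx : x ∈ U) (X Y : E n) :
    metricForm g x X Y = metricForm g x Y X := by
  rw [metricForm_apply, metricForm_apply, metricInner, metricInner, Finset.sum_comm]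
  refine Finset.sum_congr rfl fun i _ => Finset.sum_congr rfl fun j _ => ?_
  rw [hg.symm hx j i]
  ring

theorem IsMetricOn.partialDeriv_symm (hg : IsMetricOn g U) (hU : IsOpen U) {x : E n} (hx : x ∈ U)
    (i j k : Fin n) :
    partialDeriv k (fun y => g y i j) x = partialDeriv k (fun y => g y j i) x := by
  rw [partialDeriv, partialDeriv, Filter.EventuallyEq.fderiv_eq]
  filter_upwards [hU.mem_nhds hx] with y hy
  exact hg.symm hy i j

theorem IsMetricOn.metricForm_eq_zero (hg : IsMetricOn g U) {x : E n} (hx : x ∈ U) {X : E n}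
    (h : ∀ Y, metricForm g x X Y = 0) : X = 0 := by
  by_contra hne
  have hpos := (hg.posDef x hx).dotProduct_mulVec_pos (x := X.ofLp) (by simpa using hne)
  have h0 := h X
  rw [metricForm_apply, metricInner] at h0
  apply hpos.ne'
  rw [← h0]
  simp only [dotProduct, Matrix.mulVec, star_trivial, Finset.mul_sum]
  refine Finset.sum_congr rfl fun i _ => Finset.sum_congr rfl fun j _ => ?_
  ring

theorem christoffel_symm (hg : IsMetricOn g U) (hU : IsOpen U) {x : E n} (hx : x ∈ U)
    (k i j : Fin n) : christoffel g k i j x = christoffel g k j i x := by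
  simp only [christoffel]
  congr 1
  refine Finset.sum_congr rfl fun l _ => ?_
  rw [hg.partialDeriv_symm hU hx i j l]
  ring

theorem IsMetricOn.christoffelForm_symm (hg : IsMetricOn g U) (hU : IsOpen U) {x : E n}
    (hx : x ∈ U) (X Y : E n) : christoffelForm g x X Y = christoffelForm g x Y X := by
  ext k
  rw [christoffelForm_apply, christoffelForm_apply, Finset.sum_comm]
  refine Finset.sum_congr rfl fun i _ => Finset.sum_congr rfl fun j _ => ?_
  rw [christoffel_symm hg hU hx k j i]
  ring

theorem IsMetricOn.fderiv_metricForm_apply (hg : IsMetricOn g U) (hU : IsOpen U) {x : E n}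
    (hx : x ∈ U) (Z X Y : E n) :
    fderiv ℝ (metricForm g) x Z X Y
      = ∑ a, ∑ b, fderiv ℝ (fun y => g y a b) x Z * X a * Y b := by
  have h : HasFDerivAt (metricForm g) (∑ a, ∑ b, (fderiv ℝ (fun y => g y a b) x).smulRight
      ((EuclideanSpace.proj a : E n →L[ℝ] ℝ).smulRight (EuclideanSpace.proj b : E n →L[ℝ] ℝ))) x :=
    HasFDerivAt.fun_sum fun a _ => HasFDerivAt.fun_sum fun b _ =>
      (differentiableAt_of_contDiffOn hU (hg.smooth a b) hx).hasFDerivAt.smul_const _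
  rw [h.fderiv]
  simp [mul_assoc]

theorem IsMetricOn.fderiv_christoffelForm_apply (hg : IsMetricOn g U) (hU : IsOpen U) {x : E n}
    (hx : x ∈ U) (X Y Z : E n) (d : Fin n) :
    fderiv ℝ (christoffelForm g) x X Y Z d
      = ∑ b, ∑ c, fderiv ℝ (christoffel g d b c) x X * Y b * Z c := by
  have h : HasFDerivAt (christoffelForm g)
      (∑ k, ∑ i, ∑ j, (fderiv ℝ (christoffel g k i j) x).smulRight
      ((EuclideanSpace.proj i : E n →L[ℝ] ℝ).smulRight
        ((EuclideanSpace.proj j : E n →L[ℝ] ℝ).smulRight (EuclideanSpace.single k (1 : ℝ))))) x :=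
    HasFDerivAt.fun_sum fun k _ => HasFDerivAt.fun_sum fun i _ => HasFDerivAt.fun_sum fun j _ =>
      (differentiableAt_of_contDiffOn hU (hg.contDiffOn_christoffel hU k i j)
        hx).hasFDerivAt.smul_const _
  rw [h.fderiv]
  simp [Finset.sum_apply, Pi.single_apply, mul_assoc]

theorem sum_comm_three {α : Type*} [Fintype α] (f : α → α → α → ℝ) :
    ∑ a, ∑ b, ∑ c, f a b c = ∑ c, ∑ b, ∑ a, f a b c :=
  calc _ = ∑ b, ∑ a, ∑ c, f a b c := Finset.sum_comm
    _ = ∑ b, ∑ c, ∑ a, f a b c := Finset.sum_congr rfl fun _ _ => Finset.sum_comm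
    _ = _ := Finset.sum_comm

theorem sum_comm_four {α : Type*} [Fintype α] (f : α → α → α → α → ℝ) :
    ∑ a, ∑ b, ∑ c, ∑ d, f a b c d = ∑ d, ∑ b, ∑ c, ∑ a, f a b c d :=
  calc _ = ∑ b, ∑ c, ∑ a, ∑ d, f a b c d :=
        Finset.sum_comm.trans (Finset.sum_congr rfl fun _ _ => Finset.sum_comm)
    _ = ∑ b, ∑ c, ∑ d, ∑ a, f a b c d :=
        Finset.sum_congr rfl fun _ _ => Finset.sum_congr rfl fun _ _ => Finset.sum_comm
    _ = ∑ b, ∑ d, ∑ c, ∑ a, f a b c d := Finset.sum_congr rfl fun _ _ => Finset.sum_comm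
    _ = _ := Finset.sum_comm

/-- Lowering the index cancels the inverse metric and leaves the Christoffel symbols of the first
kind. -/
theorem sum_christoffel_mul_metric (hg : IsMetricOn g U) {x : E n} (hx : x ∈ U) (i j l : Fin n) :
    ∑ k, christoffel g k i j x * g x k l = (1 / 2) * (partialDeriv i (fun y => g y j l) x
      + partialDeriv j (fun y => g y i l) x - partialDeriv l (fun y => g y i j) x) := by
  set T : Fin n → ℝ := fun l => partialDeriv i (fun y => g y j l) x
      + partialDeriv j (fun y => g y i l) x - partialDeriv l (fun y => g y i j) x with hT
  have hinv : g x * (g x)⁻¹ = 1 := Matrix.mul_nonsing_inv _ (hg.posDef x hx).det_pos.ne'.isUnit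
  have h : (g x * (g x)⁻¹).mulVec T l = T l := by rw [hinv, Matrix.one_mulVec]
  rw [← Matrix.mulVec_mulVec] at h
  change _ = (1 / 2) * T l
  rw [← h]
  simp only [Matrix.mulVec, dotProduct, Finset.mul_sum]
  refine Finset.sum_congr rfl fun k _ => ?_
  simp only [christoffel, Finset.mul_sum, Finset.sum_mul]
  refine Finset.sum_congr rfl fun m _ => ?_
  rw [hg.symm hx l k]
  ring

theorem partialDeriv_metric (hg : IsMetricOn g U) (hU : IsOpen U) {x : E n} (hx : x ∈ U)
    (c a b : Fin n) : partialDeriv c (fun y => g y a b) x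
      = ∑ m, christoffel g m c a x * g x m b + ∑ m, christoffel g m c b x * g x a m := by
  have h : ∀ m, g x a m = g x m a := fun m => hg.symm hx a m
  simp only [h, sum_christoffel_mul_metric hg hx]
  rw [hg.partialDeriv_symm hU hx b a c, hg.partialDeriv_symm hU hx c b a,
    hg.partialDeriv_symm hU hx c a b]
  ring

/-- The Levi-Civita connection is compatible with the metric. -/
theorem IsMetricOn.fderiv_metricForm (hg : IsMetricOn g U) (hU : IsOpen U) {x : E n}
    (hx : x ∈ U) (Z X Y : E n) :
    fderiv ℝ (metricForm g) x Z X Y = metricForm g x (christoffelForm g x Z X) Y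
      + metricForm g x X (christoffelForm g x Z Y) := by
  have h1 : metricForm g x (christoffelForm g x Z X) Y
      = ∑ a, ∑ b, ∑ c, (∑ m, christoffel g m c a x * g x m b) * Z c * X a * Y b := by
    simp only [metricForm_apply, metricInner, christoffelForm_apply, Finset.mul_sum,
      Finset.sum_mul]
    rw [sum_comm_four]
    refine Finset.sum_congr rfl fun a _ => Finset.sum_congr rfl fun b _ =>
      Finset.sum_congr rfl fun c _ => Finset.sum_congr rfl fun m _ => ?_
    ring
  have h2 : metricForm g x X (christoffelForm g x Z Y)
      = ∑ a, ∑ b, ∑ c, (∑ m, christoffel g m c b x * g x a m) * Z c * X a * Y b := by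
    simp only [metricForm_apply, metricInner, christoffelForm_apply, Finset.mul_sum,
      Finset.sum_mul]
    refine Finset.sum_congr rfl fun a _ => ?_
    rw [sum_comm_three]
    refine Finset.sum_congr rfl fun b _ =>
      Finset.sum_congr rfl fun c _ => Finset.sum_congr rfl fun m _ => ?_
    ring
  rw [h1, h2, hg.fderiv_metricForm_apply hU hx, ← Finset.sum_add_distrib]
  refine Finset.sum_congr rfl fun a _ => ?_
  rw [← Finset.sum_add_distrib]
  refine Finset.sum_congr rfl fun b _ => ?_
  rw [← Finset.sum_add_distrib, fderiv_apply_eq_sum, Finset.sum_mul, Finset.sum_mul]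
  refine Finset.sum_congr rfl fun c _ => ?_
  rw [partialDeriv_metric hg hU hx]
  ring

/-! ### The curvature tensor and constant sectional curvature -/

/-- The curvature tensor in terms of the bilinear map of Christoffel symbols. -/
theorem IsMetricOn.riemann_eq (hg : IsMetricOn g U) (hU : IsOpen U) {x : E n}
    (hx : x ∈ U) (X Y Z : E n) :
    riemann g x X Y Z = fderiv ℝ (christoffelForm g) x X Y Z - fderiv ℝ (christoffelForm g) x Y X Z
      + (christoffelForm g x X (christoffelForm g x Y Z)
        - christoffelForm g x Y (christoffelForm g x X Z)) := by
  ext d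
  simp only [riemann, riemannComp, PiLp.add_apply, PiLp.sub_apply,
    hg.fderiv_christoffelForm_apply hU hx, christoffelForm_apply]
  have h1 : ∑ b, ∑ c, fderiv ℝ (christoffel g d b c) x X * Y b * Z c
      = ∑ a, ∑ b, ∑ c, partialDeriv a (christoffel g d b c) x * X a * Y b * Z c := by
    simp only [fderiv_apply_eq_sum _ x X, Finset.sum_mul]
    exact (Finset.sum_congr rfl fun _ _ => Finset.sum_comm).trans Finset.sum_comm
  have h2 : ∑ a, ∑ c, fderiv ℝ (christoffel g d a c) x Y * X a * Z c
      = ∑ a, ∑ b, ∑ c, partialDeriv b (christoffel g d a c) x * X a * Y b * Z c := by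
    simp only [fderiv_apply_eq_sum _ x Y, Finset.sum_mul]
    refine Finset.sum_congr rfl fun _ _ => ?_
    rw [Finset.sum_comm]
    refine Finset.sum_congr rfl fun _ _ => Finset.sum_congr rfl fun _ _ => ?_
    ring
  have h3 : ∑ a, ∑ m, christoffel g d a m x * X a * ∑ b, ∑ c, christoffel g m b c x * Y b * Z c
      = ∑ a, ∑ b, ∑ c, ∑ m, christoffel g d a m x * christoffel g m b c x * X a * Y b * Z c := by
    simp only [Finset.mul_sum]
    refine Finset.sum_congr rfl fun _ _ => Finset.sum_comm.trans ?_
    refine Finset.sum_congr rfl fun _ _ => Finset.sum_comm.trans ?_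
    refine Finset.sum_congr rfl fun _ _ => Finset.sum_congr rfl fun _ _ => ?_
    ring
  have h4 : ∑ b, ∑ m, christoffel g d b m x * Y b * ∑ a, ∑ c, christoffel g m a c x * X a * Z c
      = ∑ a, ∑ b, ∑ c, ∑ m, christoffel g d b m x * christoffel g m a c x * X a * Y b * Z c := by
    simp only [Finset.mul_sum]
    refine ((Finset.sum_congr rfl fun _ _ => Finset.sum_comm).trans Finset.sum_comm).trans ?_
    refine Finset.sum_congr rfl fun _ _ => Finset.sum_congr rfl fun _ _ => Finset.sum_comm.trans ?_
    refine Finset.sum_congr rfl fun _ _ => Finset.sum_congr rfl fun _ _ => ?_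
    ring
  rw [h1, h2, h3, h4]
  simp only [← Finset.sum_sub_distrib, ← Finset.sum_add_distrib]
  refine Finset.sum_congr rfl fun a _ => Finset.sum_congr rfl fun b _ =>
    Finset.sum_congr rfl fun c _ => ?_
  simp only [← sub_mul, ← Finset.sum_mul]
  ring

/-- Metric compatibility is differentiated once more; the symmetry of the second derivative of the
metric then says that curvature acts by skew endomorphisms. -/
theorem IsMetricOn.riemann_antisymm (hg : IsMetricOn g U) (hU : IsOpen U) {x : E n}
    (hx : x ∈ U) (W Z X Y : E n) :
    metricForm g x (riemann g x W Z X) Y + metricForm g x X (riemann g x W Z Y) = 0 := by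
  set G := metricForm g with hG
  set Γ := christoffelForm g with hΓ
  have hGd : HasFDerivAt G (fderiv ℝ G x) x :=
    (differentiableAt_of_contDiffOn hU hg.contDiffOn_metricForm hx).hasFDerivAt
  have hΓd : HasFDerivAt Γ (fderiv ℝ Γ x) x :=
    (differentiableAt_of_contDiffOn hU (hg.contDiffOn_christoffelForm hU) hx).hasFDerivAt
  have hG2 : HasFDerivAt (fderiv ℝ G) (fderiv ℝ (fderiv ℝ G) x) x :=
    (differentiableAt_of_contDiffOn hU
      (hg.contDiffOn_metricForm.fderiv_of_isOpen hU (by simp)) hx).hasFDerivAt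
  have key : ∀ W Z : E n, fderiv ℝ (fderiv ℝ G) x W Z X Y
      = G x (fderiv ℝ Γ x W Z X) Y + G x (Γ x W (Γ x Z X)) Y + G x (Γ x Z X) (Γ x W Y)
        + (G x (Γ x W X) (Γ x Z Y) + G x X (Γ x W (Γ x Z Y)) + G x X (fderiv ℝ Γ x W Z Y)) := by
    intro W Z
    have hc : ∀ V : E n, HasFDerivAt (fun _ : E n => V) (0 : E n →L[ℝ] E n) x := fun V =>
      hasFDerivAt_const V x
    have h1 := ((hG2.clm_apply (hc Z)).clm_apply (hc X)).clm_apply (hc Y)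
    have hΓX := (hΓd.clm_apply (hc Z)).clm_apply (hc X)
    have hΓY := (hΓd.clm_apply (hc Z)).clm_apply (hc Y)
    have h2 := ((hGd.clm_apply hΓX).clm_apply (hc Y)).add ((hGd.clm_apply (hc X)).clm_apply hΓY)
    have heq : (fun y => fderiv ℝ G y Z X Y) =ᶠ[nhds x]
        fun y => G y (Γ y Z X) Y + G y X (Γ y Z Y) := by
      filter_upwards [hU.mem_nhds hx] with y hy
      exact hg.fderiv_metricForm hU hy Z X Y
    have h3 := congrArg (fun T : E n →L[ℝ] ℝ => T W) (h1.unique (h2.congr_of_eventuallyEq heq))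
    simp only [add_apply, ContinuousLinearMap.comp_apply, ContinuousLinearMap.flip_apply,
      zero_add, ContinuousLinearMap.comp_zero] at h3
    rw [h3, hg.fderiv_metricForm hU hx, hg.fderiv_metricForm hU hx]
    ring
  have hsymm : fderiv ℝ (fderiv ℝ G) x W Z = fderiv ℝ (fderiv ℝ G) x Z W :=
    ((hg.contDiffOn_metricForm.contDiffAt (hU.mem_nhds hx)).isSymmSndFDerivAt
      (by rw [minSmoothness_of_isRCLikeNormedField]; exact WithTop.coe_le_coe.2 (le_top : (2 : ℕ∞) ≤ ⊤))) W Z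
  have h := congrArg (fun T : E n →L[ℝ] E n →L[ℝ] ℝ => T X Y) hsymm
  simp only [key] at h
  rw [hg.riemann_eq hU hx, hg.riemann_eq hU hx]
  simp only [map_add, map_sub, add_apply, sub_apply]
  linarith

/-- A tensor with the symmetries of a curvature tensor is determined by its sectional values. -/
theorem curvature_like_eq_zero {M : Type*} [AddCommGroup M] {T : M → M → M → M → ℝ}
    (hadd₁ : ∀ X X' Y Z W, T (X + X') Y Z W = T X Y Z W + T X' Y Z W)
    (h₁₂ : ∀ X Y Z W, T X Y Z W = -T Y X Z W) (h₃₄ : ∀ X Y Z W, T X Y Z W = -T X Y W Z)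
    (hcyc : ∀ X Y Z W, T X Y Z W + T Y Z X W + T Z X Y W = 0)
    (hsec : ∀ X Y, T X Y Y X = 0) (X Y Z W : M) : T X Y Z W = 0 := by
  -- Pair symmetry is a linear combination of four Bianchi identities (Milnor's octahedron).
  have hpair : ∀ X Y Z W, T X Y Z W = T Z W X Y := by
    intro X Y Z W
    have a1 := hcyc X Y Z W
    have a2 := hcyc Y Z W X
    have a3 := hcyc Z W X Y
    have a4 := hcyc W X Y Z
    have b1 := h₃₄ X Y Z W
    have b2 := h₃₄ Y Z W X
    have b3 := h₃₄ Z W X Y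
    have b4 := h₃₄ W X Y Z
    have b5 := h₃₄ Z X Y W
    have b6 := h₃₄ Y W X Z
    have c1 := h₁₂ Z X W Y
    have c2 := h₁₂ W Y Z X
    have c3 := h₁₂ Z X Y W
    have c4 := h₁₂ W Y X Z
    linarith
  have hadd₂ : ∀ X Y Y' Z W, T X (Y + Y') Z W = T X Y Z W + T X Y' Z W := by
    intro X Y Y' Z W
    rw [h₁₂, hadd₁, h₁₂ X Y, h₁₂ X Y']
    ring
  have hadd₃ : ∀ X Y Z Z' W, T X Y (Z + Z') W = T X Y Z W + T X Y Z' W := by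
    intro X Y Z Z' W
    rw [hpair, hadd₁, hpair Z, hpair Z']
  have hadd₄ : ∀ X Y Z W W', T X Y Z (W + W') = T X Y Z W + T X Y Z W' := by
    intro X Y Z W W'
    rw [h₃₄, hadd₃, h₃₄ X Y Z W, h₃₄ X Y Z W']
    ring
  -- Polarisation in the outer pair; `h₂₃` then polarises the inner pair. `T` becomes totally
  -- antisymmetric, and the cyclic identity reads 3T = 0.
  have hmid : ∀ X Y Z, T X Y Y Z = 0 := by
    intro X Y Z
    have h := hsec (X + Z) Y
    rw [hadd₁, hadd₄, hadd₄, hsec, hsec] at h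
    have h1 := hpair Z Y Y X
    have h2 := h₁₂ Y X Z Y
    have h3 := h₃₄ X Y Z Y
    linarith
  have h₂₃ : ∀ X Y Z W, T X Y Z W = -T X Z Y W := by
    intro X Y Z W
    have h := hmid X (Y + Z) W
    rw [hadd₂, hadd₃, hadd₃, hmid, hmid] at h
    linarith
  have h1 := hcyc X Y Z W
  have h2 := h₁₂ Y Z X W
  have h3 := h₂₃ Z Y X W
  have h4 := h₁₂ Z X Y W
  have h5 := h₂₃ X Z Y W
  have h7 := h₂₃ Y X Z W
  have h8 := h₁₂ X Y Z W
  linarith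

/-- A metric of constant sectional curvature `-1` has the curvature tensor
`R(X, Y) Z = ⟨X, Z⟩ Y - ⟨Y, Z⟩ X`. -/
theorem HasConstSectionalCurvature.riemann_eq (hK : HasConstSectionalCurvature g U (-1))
    (hg : IsMetricOn g U) (hU : IsOpen U) {x : E n} (hx : x ∈ U) (X Y Z : E n) :
    riemann g x X Y Z = metricForm g x X Z • Y - metricForm g x Y Z • X := by
  have hsymm := hg.metricForm_symm hx
  have hΓ := hg.christoffelForm_symm hU hx
  rw [← sub_eq_zero]
  refine hg.metricForm_eq_zero hx fun W => ?_
  refine curvature_like_eq_zero (T := fun X Y Z W => metricForm g x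
    (riemann g x X Y Z - (metricForm g x X Z • Y - metricForm g x Y Z • X)) W)
    ?_ ?_ ?_ ?_ ?_ X Y Z W
  · intro X X' Y Z W
    simp only [hg.riemann_eq hU hx, map_add, map_sub, add_apply, sub_apply, map_smul, smul_apply,
      smul_eq_mul]
    ring
  · intro X Y Z W
    simp only [hg.riemann_eq hU hx, map_add, map_sub, add_apply, sub_apply, map_smul, smul_apply,
      smul_eq_mul]
    ring
  · intro X Y Z W
    have h := hg.riemann_antisymm hU hx X Y Z W
    rw [hsymm Z] at h
    simp only [map_sub, sub_apply, map_smul, smul_apply, smul_eq_mul]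
    rw [hsymm Y W, hsymm X W, hsymm Y Z, hsymm X Z]
    linarith
  · intro X Y Z W
    simp only [hg.riemann_eq hU hx, map_add, map_sub, add_apply, sub_apply, map_smul, smul_apply,
      smul_eq_mul]
    have hΓd : ∀ X Y Z, fderiv ℝ (christoffelForm g) x X Y Z
        = fderiv ℝ (christoffelForm g) x X Z Y := by
      intro X Y Z
      ext d
      rw [hg.fderiv_christoffelForm_apply hU hx, hg.fderiv_christoffelForm_apply hU hx,
        Finset.sum_comm]
      refine Finset.sum_congr rfl fun a _ => Finset.sum_congr rfl fun b _ => ?_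
      have : fderiv ℝ (christoffel g d b a) x = fderiv ℝ (christoffel g d a b) x := by
        apply Filter.EventuallyEq.fderiv_eq
        filter_upwards [hU.mem_nhds hx] with y hy
        exact christoffel_symm hg hU hy d b a
      rw [this]
      ring
    rw [hΓd X Z Y, hΓd Y X Z, hΓd Z Y X, hΓ X Z, hΓ Y X, hΓ Z Y, hsymm Z Y, hsymm Y X, hsymm Z X]
    ring
  · intro X Y
    simp only [map_sub, sub_apply, map_smul, smul_apply, smul_eq_mul]
    by_cases hli : LinearIndependent ℝ ![X, Y]
    · have h := hK x hx X Y hli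
      rw [sectionalCurvature] at h
      simp only [← metricForm_apply] at h
      -- A zero denominator would give sectional curvature 0 by the convention for division, not -1;
      -- no Cauchy–Schwarz argument is needed.
      have hden : metricForm g x X X * metricForm g x Y Y - metricForm g x X Y ^ 2 ≠ 0 := by
        intro h0
        rw [h0, div_zero] at h
        norm_num at h
      rw [div_eq_iff hden] at h
      rw [h, hsymm Y X]
      ring
    · rw [LinearIndependent.pair_iff] at hli
      push Not at hli
      obtain ⟨s, t, hst, hne⟩ := hli
      rw [hg.riemann_eq hU hx]
      by_cases ht : t = 0
      · have hs : s ≠ 0 := fun hs => hne hs ht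
        have hX : X = 0 := by simpa [ht, hs] using hst
        simp [hX]
      · have hY : Y = (-(t⁻¹ * s)) • X := by
          have : t • Y = -(s • X) := by rw [← sub_eq_zero, sub_neg_eq_add, add_comm, hst]
          rw [neg_smul, mul_smul, ← smul_neg, ← this, smul_smul, inv_mul_cancel₀ ht, one_smul]
        rw [hY]
        simp only [map_smul, smul_apply, map_sub, map_add, add_apply, sub_apply, smul_eq_mul]
        ring

end RiemannianChart

end

/-! ### The flat linear system Hess u = u g -/

noncomputable section

namespace RiemannianChart

set_option maxSynthPendingDepth 3

variable {n : ℕ} {g : E n → Matrix (Fin n) (Fin n) ℝ} {U : Set (E n)}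

/-- The right hand side of the linear system `du = p`, `∇p = u g` for a pair `(p, u)` of a covector
field and a function. -/
def hessianSystem (g : E n → Matrix (Fin n) (Fin n) ℝ) (x : E n) :
    ((E n →L[ℝ] ℝ) × ℝ) →L[ℝ] E n →L[ℝ] (E n →L[ℝ] ℝ) × ℝ :=
  LinearMap.toContinuousLinearMap
    { toFun := fun Φ => ((ContinuousLinearMap.compL ℝ (E n) (E n) ℝ Φ.1).comp (christoffelForm g x)
        + Φ.2 • metricForm g x).prod Φ.1
      map_add' := fun Φ Ψ => by
        ext X : 1
        refine Prod.ext ?_ ?_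
        · ext Y
          simp [add_mul]
          ring
        · simp
      map_smul' := fun c Φ => by
        ext X : 1
        refine Prod.ext ?_ ?_
        · ext Y
          simp [mul_assoc]
        · simp }

theorem hessianSystem_apply (x : E n) (p : E n →L[ℝ] ℝ) (u : ℝ) (X : E n) :
    hessianSystem g x (p, u) X = (p.comp (christoffelForm g x X) + u • metricForm g x X, p X) :=
  rfl

theorem IsMetricOn.contDiffOn_hessianSystem (hg : IsMetricOn g U) (hU : IsOpen U) :
    ContDiffOn ℝ ∞ (hessianSystem g) U := by
  rw [contDiffOn_clm_apply]
  rintro ⟨p, u⟩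
  rw [contDiffOn_clm_apply]
  intro X
  simp only [hessianSystem_apply]
  refine ContDiffOn.prodMk ?_ contDiffOn_const
  exact (contDiffOn_const.clm_comp
    ((hg.contDiffOn_christoffelForm hU).clm_apply contDiffOn_const)).add
    ((hg.contDiffOn_metricForm.clm_apply contDiffOn_const).const_smul u)

/-- The obstruction in the covector component is p(R(X, Y)Z) plus the commutator of the terms u g,
whose contribution through du = p is exactly cancelled by the curvature formula; metric
compatibility disposes of the terms in u. In the scalar component the obstruction vanishes by the
symmetry of Γ and g. -/
theorem HasConstSectionalCurvature.isFlatOn_hessianSystem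
    (hK : HasConstSectionalCurvature g U (-1)) (hg : IsMetricOn g U) (hU : IsOpen U) :
    IsFlatOn (hessianSystem g) U := by
  rintro x hx ⟨p, u⟩ X Y
  have hAd : HasFDerivAt (hessianSystem g) (fderiv ℝ (hessianSystem g) x) x :=
    (differentiableAt_of_contDiffOn hU (hg.contDiffOn_hessianSystem hU) hx).hasFDerivAt
  have hGd : HasFDerivAt (metricForm g) (fderiv ℝ (metricForm g) x) x :=
    (differentiableAt_of_contDiffOn hU hg.contDiffOn_metricForm hx).hasFDerivAt
  have hΓd : HasFDerivAt (christoffelForm g) (fderiv ℝ (christoffelForm g) x) x :=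
    (differentiableAt_of_contDiffOn hU (hg.contDiffOn_christoffelForm hU) hx).hasFDerivAt
  have hd : ∀ X Y Z : E n, (fderiv ℝ (hessianSystem g) x X (p, u) Y).1 Z
      = p (fderiv ℝ (christoffelForm g) x X Y Z) + u * fderiv ℝ (metricForm g) x X Y Z ∧
      (fderiv ℝ (hessianSystem g) x X (p, u) Y).2 = 0 := by
    intro X Y Z
    have h1 := (hAd.clm_apply (hasFDerivAt_const (p, u) x)).clm_apply (hasFDerivAt_const Y x)
    have h2 := ((hasFDerivAt_const p x).clm_apply
      ((hΓd.clm_apply (hasFDerivAt_const Y x)).clm_apply (hasFDerivAt_const Z x))).add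
      (((hGd.clm_apply (hasFDerivAt_const Y x)).clm_apply (hasFDerivAt_const Z x)).const_mul u)
    have h3 := congrArg (fun T : E n →L[ℝ] ℝ => T X)
      ((h1.fst.clm_apply (hasFDerivAt_const Z x)).unique h2)
    have h4 := congrArg (fun T : E n →L[ℝ] ℝ => T X) (h1.snd.unique (hasFDerivAt_const (p Y) x))
    constructor
    · simpa using h3
    · simpa using h4
  refine Prod.ext ?_ ?_
  · ext Z
    have hR := congrArg p (hK.riemann_eq hg hU hx X Y Z)
    rw [hg.riemann_eq hU hx] at hR
    simp only [Prod.fst_add, add_apply, (hd _ _ _).1, hessianSystem_apply,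
      hg.fderiv_metricForm hU hx, ContinuousLinearMap.comp_apply, smul_apply, smul_eq_mul]
    simp only [map_add, map_sub, map_smul, smul_eq_mul] at hR
    rw [hg.christoffelForm_symm hU hx Y X, hg.metricForm_symm hx X (christoffelForm g x Y Z),
      hg.metricForm_symm hx Y (christoffelForm g x X Z)]
    linarith
  · simp only [Prod.snd_add, (hd _ _ 0).2, hessianSystem_apply, add_apply,
      ContinuousLinearMap.comp_apply, smul_apply, smul_eq_mul]
    rw [hg.christoffelForm_symm hU hx Y X, hg.metricForm_symm hx X Y]

/-! ### Orthonormal frames -/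

variable {e : Fin n → E n → E n}

theorem dualForm_eq (i : Fin n) (x : E n) : dualForm g e i x = metricForm g x (e i x) := by
  ext X
  rw [metricForm_apply, metricInner, Finset.sum_comm]
  simp [dualForm, Finset.sum_mul]

theorem IsOrthonormalFrame.metricForm_apply (he : IsOrthonormalFrame g U e) {x : E n} (hx : x ∈ U)
    (i j : Fin n) : metricForm g x (e i x) (e j x) = if i = j then 1 else 0 := by
  rw [RiemannianChart.metricForm_apply, he.orthonormal x hx]

theorem IsOrthonormalFrame.sum_dualForm_smul (he : IsOrthonormalFrame g U e) {x : E n}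
    (hx : x ∈ U) (X : E n) : ∑ k, dualForm g e k x X • e k x = X := by
  let P : Matrix (Fin n) (Fin n) ℝ := Matrix.of fun i a => e i x a
  let Q : Matrix (Fin n) (Fin n) ℝ := Matrix.of fun b j => ∑ a, g x a b * e j x a
  have h1 : P * Q = 1 := by
    ext i j
    have h := dualForm_frame he hx j i
    simp only [dualForm, sum_apply, smul_apply, PiLp.proj_apply, smul_eq_mul] at h
    rw [Matrix.mul_apply, Matrix.one_apply]
    simp only [P, Q, Matrix.of_apply, eq_comm (a := i)]
    rw [← h]
    exact Finset.sum_congr rfl fun b _ => mul_comm _ _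
  -- Orthonormality gives one product of square matrices; the expansion of a vector in the frame is
  -- the other one.
  have h2 : Q * P = 1 := mul_eq_one_comm.1 h1
  ext a
  simp only [WithLp.ofLp_sum, WithLp.ofLp_smul, Finset.sum_apply, Pi.smul_apply, smul_eq_mul,
    dualForm, sum_apply, smul_apply, PiLp.proj_apply]
  have h3 : ∀ b, ∑ k, Q b k * P k a = if b = a then 1 else 0 := fun b => by
    rw [← Matrix.mul_apply, h2, Matrix.one_apply]
  calc ∑ k, (∑ b, (∑ c, g x c b * e k x c) * X b) * e k x a
      = ∑ b, (∑ k, Q b k * P k a) * X b := by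
        simp only [Finset.sum_mul]
        rw [Finset.sum_comm]
        refine Finset.sum_congr rfl fun b _ => Finset.sum_congr rfl fun k _ => ?_
        simp only [Q, P, Matrix.of_apply, Finset.sum_mul]
        refine Finset.sum_congr rfl fun c _ => ?_
        ring
    _ = X a := by simp [h3]

/-- The connection form `ω_ij` as a field of continuous linear forms. -/
def connectionForm (g : E n → Matrix (Fin n) (Fin n) ℝ) (e : Fin n → E n → E n) (i j : Fin n)
    (x : E n) : E n →L[ℝ] ℝ :=
  ((metricForm g x).flip (e j x)).comp (fderiv ℝ (e i) x + (christoffelForm g x).flip (e i x))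

theorem IsOrthonormalFrame.differentiableAt (he : IsOrthonormalFrame g U e) (hU : IsOpen U)
    {x : E n} (hx : x ∈ U) (i : Fin n) : DifferentiableAt ℝ (e i) x :=
  differentiableAt_of_contDiffOn hU (he.smooth i) hx

theorem covDeriv_eq {Y : E n → E n} {x : E n} (hY : DifferentiableAt ℝ Y x) (X : E n) :
    covDeriv g Y x X = fderiv ℝ Y x X + christoffelForm g x X (Y x) := by
  ext k
  rw [PiLp.add_apply, christoffelForm_apply]
  have h : HasFDerivAt (fun y => Y y k)
      ((EuclideanSpace.proj k : E n →L[ℝ] ℝ).comp (fderiv ℝ Y x)) x :=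
    (EuclideanSpace.proj k : E n →L[ℝ] ℝ).hasFDerivAt.comp x hY.hasFDerivAt
  simp [covDeriv, h.fderiv]

theorem IsOrthonormalFrame.connectionForm_apply (he : IsOrthonormalFrame g U e) (hU : IsOpen U)
    {x : E n} (hx : x ∈ U) (i j : Fin n) (X : E n) :
    connectionForm g e i j x X = connectionMatrix g e x X i j := by
  rw [connectionMatrix, Matrix.of_apply, ← RiemannianChart.metricForm_apply,
    covDeriv_eq (he.differentiableAt hU hx i)]
  rfl

/-- The constant function ⟨e_i, e_j⟩ is differentiated using metric compatibility. -/
theorem IsOrthonormalFrame.connectionForm_antisymm (he : IsOrthonormalFrame g U e)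
    (hg : IsMetricOn g U) (hU : IsOpen U) {x : E n} (hx : x ∈ U) (i j : Fin n) (X : E n) :
    connectionForm g e j i x X = -connectionForm g e i j x X := by
  have hGd : HasFDerivAt (metricForm g) (fderiv ℝ (metricForm g) x) x :=
    (differentiableAt_of_contDiffOn hU hg.contDiffOn_metricForm hx).hasFDerivAt
  have h1 := (hGd.clm_apply (he.differentiableAt hU hx i).hasFDerivAt).clm_apply
    (he.differentiableAt hU hx j).hasFDerivAt
  have h2 : (fun y => metricForm g y (e i y) (e j y)) =ᶠ[nhds x]
      fun _ => if i = j then (1 : ℝ) else 0 := by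
    filter_upwards [hU.mem_nhds hx] with y hy
    exact he.metricForm_apply hy i j
  have h3 := congrArg (fun T : E n →L[ℝ] ℝ => T X)
    (h1.unique ((hasFDerivAt_const _ x).congr_of_eventuallyEq h2))
  simp only [add_apply, ContinuousLinearMap.comp_apply, ContinuousLinearMap.flip_apply,
    hg.fderiv_metricForm hU hx, zero_apply] at h3
  simp only [connectionForm, ContinuousLinearMap.comp_apply, ContinuousLinearMap.flip_apply,
    add_apply, map_add]
  rw [hg.metricForm_symm hx _ (e i x), hg.metricForm_symm hx _ (e i x)]
  linarith

theorem IsOrthonormalFrame.sum_connectionForm_smul (he : IsOrthonormalFrame g U e)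
    (hg : IsMetricOn g U) {x : E n} (hx : x ∈ U) (i : Fin n) (X : E n) :
    ∑ j, connectionForm g e i j x X • e j x
      = fderiv ℝ (e i) x X + christoffelForm g x X (e i x) := by
  rw [← he.sum_dualForm_smul hx (fderiv ℝ (e i) x X + christoffelForm g x X (e i x))]
  refine Finset.sum_congr rfl fun j _ => ?_
  rw [dualForm_eq, hg.metricForm_symm hx]
  rfl

theorem IsOrthonormalFrame.contDiffOn_dualForm (he : IsOrthonormalFrame g U e)
    (hg : IsMetricOn g U) (i : Fin n) : ContDiffOn ℝ ∞ (dualForm g e i) U :=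
  (hg.contDiffOn_metricForm.clm_apply (he.smooth i)).congr fun x _ => dualForm_eq i x

theorem IsOrthonormalFrame.contDiffOn_connectionForm (he : IsOrthonormalFrame g U e)
    (hg : IsMetricOn g U) (hU : IsOpen U) (i j : Fin n) :
    ContDiffOn ℝ ∞ (connectionForm g e i j) U := by
  refine contDiffOn_clm_apply.2 fun X => ?_
  simp only [connectionForm, ContinuousLinearMap.comp_apply, ContinuousLinearMap.flip_apply,
    add_apply]
  exact (hg.contDiffOn_metricForm.clm_apply
    ((((he.smooth i).fderiv_of_isOpen hU (by simp)).clm_apply contDiffOn_const).add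
      (((hg.contDiffOn_christoffelForm hU).clm_apply contDiffOn_const).clm_apply
        (he.smooth i)))).clm_apply (he.smooth j)

/-- The covariant derivative of the dual form `ω_i` is `∑_j ω_ij ω_j`. -/
theorem IsOrthonormalFrame.fderiv_dualForm (he : IsOrthonormalFrame g U e)
    (hg : IsMetricOn g U) (hU : IsOpen U) {x : E n} (hx : x ∈ U) (i : Fin n) (X Y : E n) :
    fderiv ℝ (dualForm g e i) x X Y
      = ∑ j, connectionForm g e i j x X * dualForm g e j x Y
        + dualForm g e i x (christoffelForm g x X Y) := by
  have hGd : HasFDerivAt (metricForm g) (fderiv ℝ (metricForm g) x) x :=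
    (differentiableAt_of_contDiffOn hU hg.contDiffOn_metricForm hx).hasFDerivAt
  have h1 := hGd.clm_apply (he.differentiableAt hU hx i).hasFDerivAt
  have h2 : dualForm g e i = fun y => metricForm g y (e i y) := funext fun y => dualForm_eq i y
  have h3 := congrArg (fun Z => metricForm g x Z Y) (he.sum_connectionForm_smul hg hx i X)
  simp only [map_sum, map_smul, sum_apply, smul_apply, smul_eq_mul, map_add, add_apply] at h3
  rw [h2, h1.fderiv]
  simp only [dualForm_eq, add_apply, ContinuousLinearMap.comp_apply,
    ContinuousLinearMap.flip_apply, hg.fderiv_metricForm hU hx]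
  rw [h3]
  ring

/-- Existence of solutions of the linear system, in frame components: a function `u` and the
components `P k` of its gradient. -/
theorem exists_frame_solution (hg : IsMetricOn g U) (hU : IsOpen U)
    (hK : HasConstSectionalCurvature g U (-1)) (he : IsOrthonormalFrame g U e)
    {V : Set (E n)} (hVU : V ⊆ U) (hV : IsOpen V) (hVs : IsSimplyConnected V) {x₀ : E n}
    (hx₀ : x₀ ∈ V) (P₀ : Fin n → ℝ) (u₀ : ℝ) :
    ∃ (P : Fin n → E n → ℝ) (u : E n → ℝ), (∀ k, P k x₀ = P₀ k) ∧ u x₀ = u₀ ∧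
      (∀ k, ContDiffOn ℝ ∞ (P k) V) ∧ ContDiffOn ℝ ∞ u V ∧
      (∀ x ∈ V, ∀ k, HasFDerivAt (P k)
        (∑ j, P j x • connectionForm g e k j x + u x • dualForm g e k x) x) ∧
      ∀ x ∈ V, HasFDerivAt u (∑ k, P k x • dualForm g e k x) x := by
  have hA : ContDiffOn ℝ ∞ (hessianSystem g) V := (hg.contDiffOn_hessianSystem hU).mono hVU
  have hflat : IsFlatOn (hessianSystem g) V := fun x hx =>
    hK.isFlatOn_hessianSystem hg hU x (hVU hx)
  obtain ⟨Φ, hΦ0, hΦ⟩ := hflat.exists_solution hV hVs (hA.of_le (by simp)) hx₀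
    (∑ k, P₀ k • dualForm g e k x₀, u₀)
  have hsmooth := contDiffOn_of_hasFDerivAt_linear hV hA hΦ
  refine ⟨fun k x => (Φ x).1 (e k x), fun x => (Φ x).2, fun k => ?_, by simp [hΦ0], fun k => ?_,
    hsmooth.snd, fun x hx k => ?_, fun x hx => ?_⟩
  · simp [hΦ0, dualForm_frame he (hVU hx₀)]
  · exact hsmooth.fst.clm_apply ((he.smooth k).mono hVU)
  -- d(p(e_k)) = (∇p)(e_k) + p(∇e_k): the first term is u ω_k, the second is expanded by the
  -- connection forms.
  · have h := (hΦ x hx).fst.clm_apply (he.differentiableAt hU (hVU hx) k).hasFDerivAt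
    refine h.congr_fderiv ?_
    ext X
    have h3 := congrArg (Φ x).1 (he.sum_connectionForm_smul hg (hVU hx) k X)
    simp only [map_sum, map_smul, smul_eq_mul, map_add] at h3
    have h4 : hessianSystem g x (Φ x) X = _ := hessianSystem_apply x (Φ x).1 (Φ x).2 X
    simp only [add_apply, ContinuousLinearMap.comp_apply, ContinuousLinearMap.flip_apply,
      ContinuousLinearMap.coe_fst', h4, smul_apply, smul_eq_mul, sum_apply]
    rw [dualForm_eq, hg.metricForm_symm (hVU hx) (e k x)]
    have h5 : ∑ j, (Φ x).1 (e j x) * connectionForm g e k j x X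
        = ∑ j, connectionForm g e k j x X * (Φ x).1 (e j x) :=
      Finset.sum_congr rfl fun _ _ => mul_comm _ _
    rw [h5, h3]
    ring
  · refine (hΦ x hx).snd.congr_fderiv ?_
    ext X
    have h4 : hessianSystem g x (Φ x) X = _ := hessianSystem_apply x (Φ x).1 (Φ x).2 X
    have h3 := congrArg (Φ x).1 (he.sum_dualForm_smul (hVU hx) X)
    simp only [map_sum, map_smul, smul_eq_mul] at h3
    simp only [ContinuousLinearMap.comp_apply, ContinuousLinearMap.coe_snd', h4, sum_apply,
      smul_apply, smul_eq_mul]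
    rw [← h3]
    exact Finset.sum_congr rfl fun _ _ => mul_comm _ _

end RiemannianChart

end

/-! ### Normal form of the system and uniqueness -/

noncomputable section

namespace RiemannianChart

set_option maxSynthPendingDepth 3

variable {n : ℕ}

/-- Solving the system for `dL`: with `B = dL Lᵗ + L W Lᵗ` antisymmetric, the equations determine
all entries of `B`. Here `D`, `W`, `a` are the values of `dL`, `W` and `(ω_k)` at a vector. -/
theorem eq_normal_form_of_system [NeZero n] {L D W : Matrix (Fin n) (Fin n) ℝ} {a : Fin n → ℝ}
    (hL : Lᵀ * L = 1) (hB : (D * Lᵀ + L * W * Lᵀ)ᵀ = -(D * Lᵀ + L * W * Lᵀ))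
    (h1 : ∀ i, i ≠ 0 → (D * Lᵀ) 0 i + (L * W * Lᵀ) 0 i + ∑ k, L i k * a k = 0)
    (h2 : ∀ i j, i ≠ 0 → j ≠ 0 → i ≠ j → (D * Lᵀ) i j + (L * W * Lᵀ) i j = 0) (i k : Fin n) :
    D i k = -(L * W) i k + L 0 k * (∑ j, L i j * a j) - if i = 0 then a k else 0 := by
  set B := D * Lᵀ + L * W * Lᵀ with hBdef
  have hanti : ∀ i j, B j i = -B i j := fun i j => congrFun (congrFun hB i) j
  have hdiag : ∀ i, B i i = 0 := fun i => by linarith [hanti i i]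
  have hD : D = B * L - L * W := by
    rw [hBdef, Matrix.add_mul, Matrix.mul_assoc D, Matrix.mul_assoc (L * W), hL, Matrix.mul_one,
      Matrix.mul_one, add_sub_cancel_right]
  -- The system gives row 0 and the off-diagonal entries away from it; skewness supplies column 0
  -- and the diagonal.
  have hentry : ∀ i j, B i j = (if j = 0 then ∑ k, L i k * a k else 0)
      - if i = 0 then ∑ k, L j k * a k else 0 := by
    intro i j
    by_cases hi : i = 0
    · by_cases hj : j = 0
      · subst hi hj; simp [hdiag]
      · subst hi
        have h := h1 j hj
        rw [if_neg hj, if_pos rfl]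
        change (D * Lᵀ) 0 j + (L * W * Lᵀ) 0 j = _
        linarith
    · by_cases hj : j = 0
      · subst hj
        have h := h1 i hi
        rw [if_pos rfl, if_neg hi, hanti 0 i]
        change -((D * Lᵀ) 0 i + (L * W * Lᵀ) 0 i) = _
        linarith
      · rw [if_neg hi, if_neg hj, sub_zero]
        by_cases hij : i = j
        · subst hij; exact hdiag i
        · exact h2 i j hi hj hij
  have hLL : ∀ j, ∑ i, (∑ k, L i k * a k) * L i j = a j := fun j => by
    have h : ∀ k, ∑ i, L i k * L i j = if k = j then 1 else 0 := fun k => by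
      rw [← Matrix.one_apply, ← hL, Matrix.mul_apply]
      rfl
    calc ∑ i, (∑ k, L i k * a k) * L i j = ∑ k, (∑ i, L i k * L i j) * a k := by
          simp only [Finset.sum_mul]
          rw [Finset.sum_comm]
          exact Finset.sum_congr rfl fun _ _ => Finset.sum_congr rfl fun _ _ => by ring
      _ = a j := by simp [h]
  rw [hD, Matrix.sub_apply, Matrix.mul_apply]
  simp only [hentry, sub_mul, Finset.sum_sub_distrib, ite_mul, zero_mul, Finset.sum_ite_eq',
    Finset.mem_univ, if_true]
  split_ifs with hi
  · rw [hLL]; ring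
  · simp; ring

/-- Multiplying the normal form by Lᵗ, the term in L_0k disappears because row 0 is orthogonal to
row j. The conditional merges the two families of equations. -/
theorem system_of_eq_normal_form [NeZero n] {L D W : Matrix (Fin n) (Fin n) ℝ} {a : Fin n → ℝ}
    (hL : L * Lᵀ = 1)
    (hD : ∀ i k, D i k = -(L * W) i k + L 0 k * (∑ j, L i j * a j) - if i = 0 then a k else 0)
    {i j : Fin n} (hj : j ≠ 0) :
    (D * Lᵀ) i j + (L * W * Lᵀ) i j + (if i = 0 then ∑ k, L j k * a k else 0) = 0 := by
  have h0 : ∑ k, L 0 k * L j k = 0 := by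
    have h := congrFun (congrFun hL 0) j
    rw [Matrix.mul_apply, Matrix.one_apply, if_neg hj.symm] at h
    exact h
  rw [Matrix.mul_apply, Matrix.mul_apply, ← Finset.sum_add_distrib]
  simp only [hD, Matrix.transpose_apply]
  have h1 : ∀ k, (-(L * W) i k + L 0 k * (∑ j, L i j * a j) - if i = 0 then a k else 0) * L j k
      + (L * W) i k * L j k = (L 0 k * L j k) * (∑ j, L i j * a j)
        - if i = 0 then L j k * a k else 0 := fun k => by
    split_ifs <;> ring
  simp only [h1, Finset.sum_sub_distrib, ← Finset.sum_mul, h0, zero_mul]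
  split_ifs <;> simp

variable [NeZero n] {g : E n → Matrix (Fin n) (Fin n) ℝ} {U : Set (E n)}
  {e : Fin n → E n → E n} {V : Set (E n)} {L : E n → Matrix (Fin n) (Fin n) ℝ}

/-- The derivative of a solution, as prescribed by the system. -/
def solutionDeriv (g : E n → Matrix (Fin n) (Fin n) ℝ) (e : Fin n → E n → E n)
    (L : E n → Matrix (Fin n) (Fin n) ℝ) (x : E n) (i k : Fin n) : E n →L[ℝ] ℝ :=
  ∑ j, L x i j • connectionForm g e k j x + L x 0 k • ∑ j, L x i j • dualForm g e j x
    - if i = 0 then dualForm g e k x else 0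

theorem solutionDeriv_apply (hg : IsMetricOn g U) (hU : IsOpen U)
    (he : IsOrthonormalFrame g U e) {x : E n} (hx : x ∈ U) (i k : Fin n) (X : E n) :
    solutionDeriv g e L x i k X = -(L x * connectionMatrix g e x X) i k
      + L x 0 k * (∑ j, L x i j * dualForm g e j x X)
      - if i = 0 then dualForm g e k x X else 0 := by
  have h : ∀ j, connectionForm g e k j x X = -connectionMatrix g e x X j k := fun j => by
    rw [he.connectionForm_antisymm hg hU hx, he.connectionForm_apply hU hx]
  rw [solutionDeriv, Matrix.mul_apply]
  split_ifs <;> simp [h]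

theorem isSolutionOn_of_hasFDerivAt (hg : IsMetricOn g U) (hU : IsOpen U)
    (he : IsOrthonormalFrame g U e) (hVU : V ⊆ U)
    (hO : ∀ x ∈ V, L x ∈ Matrix.orthogonalGroup (Fin n) ℝ)
    (hL : ∀ x ∈ V, ∀ i k, HasFDerivAt (fun y => L y i k) (solutionDeriv g e L x i k) x) :
    IsSolutionOn g e V L := by
  have hD : ∀ x ∈ V, ∀ X i k, matrixDiff L x X i k = -(L x * connectionMatrix g e x X) i k
      + L x 0 k * (∑ j, L x i j * dualForm g e j x X)
      - if i = 0 then dualForm g e k x X else 0 := fun x hx X i k => by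
    rw [← solutionDeriv_apply hg hU he (hVU hx), matrixDiff, Matrix.of_apply,
      (hL x hx i k).fderiv]
  have hLL : ∀ x ∈ V, L x * (L x)ᵀ = 1 := fun x hx =>
    (Matrix.mem_orthogonalGroup_iff _ _).1 (hO x hx)
  refine ⟨fun i k x hx => (hL x hx i k).differentiableAt.differentiableWithinAt, hO, ?_, ?_⟩
  · intro x hx X i hi
    have h := system_of_eq_normal_form (hLL x hx) (hD x hx X) (i := 0) hi
    rwa [if_pos rfl] at h
  · intro x hx X i j hi hj _
    have h := system_of_eq_normal_form (hLL x hx) (hD x hx X) (i := i) hj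
    rwa [if_neg hi, add_zero] at h

/-- Differentiating L Lᵗ = 1 shows dL Lᵗ skew; with W skew this is the skewness needed to solve the
system for dL. -/
theorem IsSolutionOn.hasFDerivAt (hL : IsSolutionOn g e V L) (hg : IsMetricOn g U) (hU : IsOpen U)
    (he : IsOrthonormalFrame g U e) (hVU : V ⊆ U) (hV : IsOpen V) {x : E n} (hx : x ∈ V)
    (i k : Fin n) : HasFDerivAt (fun y => L y i k) (solutionDeriv g e L x i k) x := by
  have hd : ∀ i k, HasFDerivAt (fun y => L y i k) (fderiv ℝ (fun y => L y i k) x) x :=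
    fun i k => ((hL.differentiable i k).differentiableAt (hV.mem_nhds hx)).hasFDerivAt
  have hLL : ∀ y ∈ V, L y * (L y)ᵀ = 1 := fun y hy =>
    (Matrix.mem_orthogonalGroup_iff _ _).1 (hL.orthogonal y hy)
  refine (hd i k).congr_fderiv ?_
  ext X
  rw [solutionDeriv_apply hg hU he (hVU hx)]
  refine eq_normal_form_of_system (D := matrixDiff L x X) (a := fun k => dualForm g e k x X)
    (mul_eq_one_comm.1 (hLL x hx)) ?_ (hL.eq_first x hx X) (hL.eq_rest x hx X) i k
  have hW : (connectionMatrix g e x X)ᵀ = -connectionMatrix g e x X := by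
    ext i j
    rw [Matrix.transpose_apply, Matrix.neg_apply, ← he.connectionForm_apply hU (hVU hx),
      ← he.connectionForm_apply hU (hVU hx), he.connectionForm_antisymm hg hU (hVU hx)]
  have hDL : L x * (matrixDiff L x X)ᵀ = -(matrixDiff L x X * (L x)ᵀ) := by
    rw [eq_neg_iff_add_eq_zero]
    ext i j
    have h1 : HasFDerivAt (fun y => ∑ k, L y i k * L y j k)
        (∑ k, (L x i k • fderiv ℝ (fun y => L y j k) x
          + L x j k • fderiv ℝ (fun y => L y i k) x)) x :=
      HasFDerivAt.fun_sum fun k _ => (hd i k).mul (hd j k)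
    have h2 : (fun y => ∑ k, L y i k * L y j k) =ᶠ[nhds x]
        fun _ => (1 : Matrix (Fin n) (Fin n) ℝ) i j := by
      filter_upwards [hV.mem_nhds hx] with y hy
      rw [← hLL y hy, Matrix.mul_apply]
      rfl
    have h3 := congrArg (fun T : E n →L[ℝ] ℝ => T X)
      (h1.unique ((hasFDerivAt_const _ x).congr_of_eventuallyEq h2))
    simp only [sum_apply, add_apply, smul_apply, smul_eq_mul, zero_apply] at h3
    rw [Matrix.add_apply, Matrix.mul_apply, Matrix.mul_apply, ← Finset.sum_add_distrib,
      Matrix.zero_apply, ← h3]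
    refine Finset.sum_congr rfl fun k _ => ?_
    simp only [matrixDiff, Matrix.transpose_apply, Matrix.of_apply]
    ring
  rw [Matrix.transpose_add, Matrix.transpose_mul, Matrix.transpose_mul, Matrix.transpose_mul,
    Matrix.transpose_transpose, hW, hDL, Matrix.neg_mul, Matrix.mul_neg, ← Matrix.mul_assoc,
    neg_add]

/-- Uniqueness of solutions. -/
theorem IsSolutionOn.eqOn {L' : E n → Matrix (Fin n) (Fin n) ℝ} (hL : IsSolutionOn g e V L)
    (hL' : IsSolutionOn g e V L') (hg : IsMetricOn g U) (hU : IsOpen U)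
    (he : IsOrthonormalFrame g U e) (hVU : V ⊆ U) (hV : IsOpen V) (hVc : IsPreconnected V)
    {x₀ : E n} (hx₀ : x₀ ∈ V) (h0 : L x₀ = L' x₀) : Set.EqOn L L' V := by
  let f : E n → Fin n → Fin n → ℝ := fun y i k => L y i k - L' y i k
  let f' : E n → E n →L[ℝ] Fin n → Fin n → ℝ := fun y => ContinuousLinearMap.pi fun i =>
    ContinuousLinearMap.pi fun k => solutionDeriv g e L y i k - solutionDeriv g e L' y i k
  have hf : ∀ y ∈ V, HasFDerivAt f (f' y) y := fun y hy =>
    hasFDerivAt_pi.2 fun i => hasFDerivAt_pi.2 fun k =>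
      (hL.hasFDerivAt hg hU he hVU hV hy i k).sub (hL'.hasFDerivAt hg hU he hVU hV hy i k)
  have hentry : ∀ y i k, |f y i k| ≤ ‖f y‖ := fun y i k =>
    (norm_le_pi_norm (f y i) k).trans (norm_le_pi_norm (f y) i)
  let c : Fin n → Fin n → E n → ℝ := fun i k y => ∑ j, ‖connectionForm g e k j y‖
    + (‖∑ j, L y i j • dualForm g e j y‖ + |L' y 0 k| * ∑ j, ‖dualForm g e j y‖)
  have hbound : ∀ y i k, ‖solutionDeriv g e L y i k - solutionDeriv g e L' y i k‖
      ≤ c i k y * ‖f y‖ := by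
    intro y i k
    -- The quadratic term is split as ab - a'b' = (a - a')b + a'(b - b'), so each summand is linear
    -- in `f`.
    have heq : solutionDeriv g e L y i k - solutionDeriv g e L' y i k
        = ∑ j, f y i j • connectionForm g e k j y
          + (f y 0 k • ∑ j, L y i j • dualForm g e j y
            + L' y 0 k • ∑ j, f y i j • dualForm g e j y) := by
      simp only [solutionDeriv, f, sub_smul, Finset.sum_sub_distrib, smul_sub]
      abel
    have hsum : ∀ η : Fin n → E n →L[ℝ] ℝ, ‖∑ j, f y i j • η j‖ ≤ (∑ j, ‖η j‖) * ‖f y‖ := by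
      intro η
      rw [Finset.sum_mul]
      refine norm_sum_le_of_le _ fun j _ => ?_
      rw [norm_smul, mul_comm]
      exact mul_le_mul_of_nonneg_left (hentry y i j) (norm_nonneg _)
    rw [heq]
    simp only [c, add_mul]
    refine norm_add_le_of_le (hsum _) (norm_add_le_of_le ?_ ?_)
    · rw [norm_smul, mul_comm]
      exact mul_le_mul_of_nonneg_left (hentry y 0 k) (norm_nonneg _)
    · rw [norm_smul, mul_assoc]
      exact mul_le_mul_of_nonneg_left (hsum _) (norm_nonneg _)
  have hc0 : ∀ i k y, 0 ≤ c i k y := fun i k y => by positivity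
  have hcc : ∀ x ∈ V, ContinuousAt (fun y => ∑ i, ∑ k, c i k y) x := by
    intro x hx
    have h1 : ∀ k, ContinuousAt (dualForm g e k) x := fun k =>
      (differentiableAt_of_contDiffOn hU (he.contDiffOn_dualForm hg k) (hVU hx)).continuousAt
    have h2 : ∀ k j, ContinuousAt (connectionForm g e k j) x := fun k j =>
      (differentiableAt_of_contDiffOn hU (he.contDiffOn_connectionForm hg hU k j)
        (hVU hx)).continuousAt
    have h3 : ∀ i k, ContinuousAt (fun y => L y i k) x := fun i k =>
      (hL.hasFDerivAt hg hU he hVU hV hx i k).continuousAt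
    have h4 : ∀ i k, ContinuousAt (fun y => L' y i k) x := fun i k =>
      (hL'.hasFDerivAt hg hU he hVU hV hx i k).continuousAt
    refine tendsto_finsetSum _ fun i _ => tendsto_finsetSum _ fun k _ => ?_
    refine (tendsto_finsetSum _ fun j _ => (h2 k j).norm).add (Filter.Tendsto.add ?_ ?_)
    · exact (tendsto_finsetSum _ fun j _ => (h3 i j).smul (h1 j)).norm
    · exact (h4 0 k).abs.mul (tendsto_finsetSum _ fun j _ => (h1 j).norm)
  have h := eqOn_zero_of_norm_fderiv_le hV hVc hf (fun x hx => by
    refine ⟨∑ i, ∑ k, c i k x + 1,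
      ((hcc x hx).eventually (gt_mem_nhds (lt_add_one _))).mono fun y hy => ?_⟩
    have hS : 0 ≤ ∑ i, ∑ k, c i k y :=
      Finset.sum_nonneg fun i _ => Finset.sum_nonneg fun k _ => hc0 i k y
    refine le_trans ?_ (mul_le_mul_of_nonneg_right hy.le (norm_nonneg _))
    refine ContinuousLinearMap.opNorm_le_bound _ (by positivity) fun X => ?_
    refine (pi_norm_le_iff_of_nonneg (by positivity)).2 fun i =>
      (pi_norm_le_iff_of_nonneg (by positivity)).2 fun k => ?_
    refine ContinuousLinearMap.le_of_opNorm_le _ ((hbound y i k).trans ?_) X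
    refine mul_le_mul_of_nonneg_right ?_ (norm_nonneg _)
    exact (Finset.single_le_sum (f := fun k => c i k y) (fun k _ => hc0 i k y)
      (Finset.mem_univ k)).trans (Finset.single_le_sum (f := fun i => ∑ k, c i k y)
        (fun i _ => Finset.sum_nonneg fun k _ => hc0 i k y) (Finset.mem_univ i)))
    hx₀ (by ext i k; simp [f, h0])
  intro y hy
  ext i k
  exact sub_eq_zero.1 (congrFun (congrFun (h hy) i) k)

end RiemannianChart

end

/-! ### Closedness and existence -/

noncomputable section

namespace RiemannianChart

set_option maxSynthPendingDepth 3

variable {n : ℕ} {g : E n → Matrix (Fin n) (Fin n) ℝ} {U : Set (E n)}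
  {e : Fin n → E n → E n} {V : Set (E n)}

/-- This is the cancellation of the connection terms in the derivative of ∑ a_k b_k, used both for
the closed form and for the conserved Lorentz products. -/
theorem IsOrthonormalFrame.sum_sum_connectionForm (he : IsOrthonormalFrame g U e)
    (hg : IsMetricOn g U) (hU : IsOpen U) {x : E n} (hx : x ∈ U) (a b : Fin n → ℝ) (X : E n) :
    ∑ k, a k * ∑ j, b j * connectionForm g e k j x X
      = -∑ k, b k * ∑ j, a j * connectionForm g e k j x X := by
  simp only [Finset.mul_sum]
  rw [Finset.sum_comm, ← Finset.sum_neg_distrib]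
  refine Finset.sum_congr rfl fun i _ => ?_
  rw [← Finset.sum_neg_distrib]
  refine Finset.sum_congr rfl fun j _ => ?_
  rw [he.connectionForm_antisymm hg hU hx i j]
  ring

/-- A one-form with symmetric derivative is closed. -/
theorem isClosedFormOn_of_fderiv_symm {θ : E n → E n →L[ℝ] ℝ} {θ' : E n → E n →L[ℝ] E n →L[ℝ] ℝ}
    (hd : ∀ x ∈ V, HasFDerivAt θ (θ' x) x) (hs : ∀ x ∈ V, ∀ X Y, θ' x X Y = θ' x Y X) :
    IsClosedFormOn θ V := by
  refine ⟨fun x hx => (hd x hx).differentiableAt.differentiableWithinAt, fun x hx => ?_⟩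
  have hdiff : DifferentiableAt ℝ
      (fun y => ContinuousAlternatingMap.ofSubsingleton ℝ (E n) ℝ (0 : Fin 1) (θ y)) x :=
    ((ContinuousAlternatingMap.ofSubsingletonLIE (𝕜 := ℝ) (E := E n) (F := ℝ)
      (0 : Fin 1)).toContinuousLinearEquiv.differentiableAt).comp x (hd x hx).differentiableAt
  ext v
  rw [extDeriv_apply hdiff]
  have h : ∀ Y : E n, HasFDerivAt (fun y => θ y Y) ((θ' x).flip Y) x := fun Y => by
    simpa using (hd x hx).clm_apply (hasFDerivAt_const Y x)
  simp [Fin.sum_univ_two, (h _).fderiv, Fin.removeNth, hs x hx (v 1) (v 0)]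

theorem isOrthonormalFrame_of_orthogonal (he : IsOrthonormalFrame g U e) (hVU : V ⊆ U)
    {L : E n → Matrix (Fin n) (Fin n) ℝ} (hL : ∀ i j, ContDiffOn ℝ ∞ (fun x => L x i j) V)
    (hO : ∀ x ∈ V, L x ∈ Matrix.orthogonalGroup (Fin n) ℝ) :
    IsOrthonormalFrame g V (fun i x => ∑ j, L x i j • e j x) := by
  refine ⟨fun i => ContDiffOn.sum fun j _ => (hL i j).smul ((he.smooth j).mono hVU), ?_⟩
  intro x hx i j
  have h : L x * (L x)ᵀ = 1 :=
    (Matrix.mem_orthogonalGroup_iff _ _).1 (hO x hx)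
  rw [← metricForm_apply, ← Matrix.one_apply, ← h, Matrix.mul_apply]
  simp [he.metricForm_apply (hVU hx), mul_comm]

variable [NeZero n]

/-- The form `∑ L_1k ω_k` of a solution is closed. -/
theorem IsSolutionOn.isClosedFormOn {L : E n → Matrix (Fin n) (Fin n) ℝ}
    (hL : IsSolutionOn g e V L) (hg : IsMetricOn g U) (hU : IsOpen U)
    (he : IsOrthonormalFrame g U e) (hVU : V ⊆ U) (hV : IsOpen V) :
    IsClosedFormOn (fun x => ∑ k, L x 0 k • dualForm g e k x) V := by
  refine isClosedFormOn_of_fderiv_symm (θ' := fun x => ∑ k, (L x 0 k • fderiv ℝ (dualForm g e k) x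
    + (solutionDeriv g e L x 0 k).smulRight (dualForm g e k x))) (fun x hx => ?_)
    fun x hx X Y => ?_
  · exact HasFDerivAt.fun_sum fun k _ => (hL.hasFDerivAt hg hU he hVU hV hx 0 k).smul
      (differentiableAt_of_contDiffOn hU (he.contDiffOn_dualForm hg k) (hVU hx)).hasFDerivAt
  -- This is ∇θ = θ ⊗ θ - g plus the Christoffel term θ(Γ(X, Y)); every summand is symmetric in X
  -- and Y.
  · have hformula : ∀ X Y : E n, (∑ k, (L x 0 k • fderiv ℝ (dualForm g e k) x
        + (solutionDeriv g e L x 0 k).smulRight (dualForm g e k x))) X Y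
        = ∑ k, L x 0 k * dualForm g e k x (christoffelForm g x X Y)
          + (∑ k, L x 0 k * dualForm g e k x X) * (∑ k, L x 0 k * dualForm g e k x Y)
          - ∑ k, dualForm g e k x X * dualForm g e k x Y := by
      intro X Y
      have hskew := he.sum_sum_connectionForm hg hU (hVU hx) (fun k => dualForm g e k x Y)
        (fun k => L x 0 k) X
      have h1 : ∀ k, L x 0 k * ∑ j, connectionForm g e k j x X * dualForm g e j x Y
          = L x 0 k * ∑ j, dualForm g e j x Y * connectionForm g e k j x X := fun k => by
        simp only [mul_comm]
      have h2 : ∀ k, solutionDeriv g e L x 0 k X * dualForm g e k x Y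
          = dualForm g e k x Y * ∑ j, L x 0 j * connectionForm g e k j x X
            + (∑ j, L x 0 j * dualForm g e j x X) * (L x 0 k * dualForm g e k x Y)
            - dualForm g e k x X * dualForm g e k x Y := fun k => by
        simp only [solutionDeriv, if_true, sub_apply, add_apply, sum_apply, smul_apply,
          smul_eq_mul]
        ring
      simp only [sum_apply, add_apply, smul_apply, ContinuousLinearMap.smulRight_apply,
        smul_eq_mul, he.fderiv_dualForm hg hU (hVU hx), mul_add, h1, h2, Finset.sum_add_distrib,
        Finset.sum_sub_distrib, hskew, ← Finset.mul_sum]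
      ring
    rw [hformula, hformula, hg.christoffelForm_symm hU (hVU hx) X Y,
      mul_comm (∑ k, L x 0 k * dualForm g e k x X)]
    simp only [mul_comm (dualForm g e _ x X)]

/-- Existence of solutions on simply connected domains. -/
theorem exists_isSolutionOn (hg : IsMetricOn g U) (hU : IsOpen U)
    (hK : HasConstSectionalCurvature g U (-1)) (he : IsOrthonormalFrame g U e)
    (hVU : V ⊆ U) (hV : IsOpen V) (hVs : IsSimplyConnected V) {x₀ : E n}
    (hx₀ : x₀ ∈ V) {L₀ : Matrix (Fin n) (Fin n) ℝ}
    (hL₀ : L₀ ∈ Matrix.orthogonalGroup (Fin n) ℝ) :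
    ∃ L : E n → Matrix (Fin n) (Fin n) ℝ, (∀ i j, ContDiffOn ℝ ∞ (fun x => L x i j) V) ∧
      IsSolutionOn g e V L ∧ L x₀ = L₀ := by
  have hVc : IsPreconnected V := hVs.isPathConnected.isConnected.isPreconnected
  have hL₀' : ∀ i j, ∑ k, L₀ i k * L₀ j k = if i = j then 1 else 0 := fun i j => by
    have h : L₀ * L₀ᵀ = 1 :=
      (Matrix.mem_orthogonalGroup_iff _ _).1 hL₀
    rw [← Matrix.one_apply, ← h, Matrix.mul_apply]
    rfl
  let δ : Fin n → ℝ := fun i => if i = 0 then 1 else 0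
  have hδ : δ 0 = 1 := if_pos rfl
  -- The factor 1 - 2δ_i is -1 for i = 0 and 1 otherwise: s_0 starts at 1 with gradient -L₀_0, the
  -- other s_i start at 0 with gradient L₀_i.
  choose Q s hQ₀ hs₀ hQs hss hQ hs using fun i : Fin n =>
    exists_frame_solution hg hU hK he hVU hV hVs hx₀ (fun k => (1 - 2 * δ i) * L₀ i k) (δ i)
  -- Conservation of the Lorentz product: both Q_i · Q_j and s_i s_j have differential s_i ds_j +
  -- s_j ds_i.
  have hprod : ∀ x ∈ V, ∀ i j, ∑ k, Q i k x * Q j k x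
      = s i x * s j x + ((if i = j then 1 else 0) - δ i * δ j) := by
    intro x hx i j
    have h := eqOn_zero_of_norm_fderiv_le hV hVc
      (f := fun y => ∑ k, Q i k y * Q j k y
        - (s i y * s j y + ((if i = j then 1 else 0) - δ i * δ j)))
      (f' := fun y => 0) (fun y hy => by
        have h1 : HasFDerivAt (fun y => ∑ k, Q i k y * Q j k y) _ y :=
          HasFDerivAt.fun_sum fun k _ => (hQ i y hy k).mul (hQ j y hy k)
        have h2 := h1.sub (((hs i y hy).mul (hs j y hy)).add_const
          ((if i = j then 1 else 0) - δ i * δ j))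
        refine h2.congr_fderiv ?_
        ext X
        have h3 := he.sum_sum_connectionForm hg hU (hVU hy) (fun k => Q i k y)
          (fun k => Q j k y) X
        have h4 : ∀ i j, ∑ k, Q i k y * (s j y * dualForm g e k y X)
            = s j y * ∑ k, Q i k y * dualForm g e k y X := fun i j => by
          rw [Finset.mul_sum]
          exact Finset.sum_congr rfl fun k _ => by ring
        simp only [sub_apply, sum_apply, add_apply, smul_apply, smul_eq_mul, mul_add,
          Finset.sum_add_distrib, zero_apply, h3, h4]
        ring)
      (fun y hy => ⟨0, Filter.Eventually.of_forall fun z => by simp⟩) hx₀ (by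
        simp only [hQ₀, hs₀]
        have h4 : ∑ k, (1 - 2 * δ i) * L₀ i k * ((1 - 2 * δ j) * L₀ j k)
            = (1 - 2 * δ i) * (1 - 2 * δ j) * ∑ k, L₀ i k * L₀ j k := by
          rw [Finset.mul_sum]
          exact Finset.sum_congr rfl fun k _ => by ring
        rw [h4, hL₀']
        by_cases hij : i = j
        · subst hij
          simp only [if_true, δ]
          split_ifs <;> norm_num
        · simp only [if_neg hij, δ]
          split_ifs with h1 h2
          · exact absurd (h1.trans h2.symm) hij
          all_goals norm_num)
    exact sub_eq_zero.1 (h hx)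
  have hPu : ∀ x ∈ V, ∀ k, |Q 0 k x| ≤ |s 0 x| := fun x hx k => by
    refine sq_le_sq.1 ?_
    have h := hprod x hx 0 0
    simp only [hδ, if_true, sub_self, add_zero, ← pow_two, one_pow] at h
    rw [← h]
    exact Finset.single_le_sum (f := fun k => Q 0 k x ^ 2) (fun k _ => sq_nonneg _)
      (Finset.mem_univ k)
  -- Since s_0 is null, its derivative is bounded by a multiple of |s_0|; one zero would force s_0 =
  -- 0 throughout, against s_0 = 1 at the base point.
  have hne : ∀ x ∈ V, s 0 x ≠ 0 := by
    intro x hx h0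
    have h := eqOn_zero_of_norm_fderiv_le hV hVc (hs 0) (fun y hy => by
      have hc : ContinuousAt (fun z => ∑ k, ‖dualForm g e k z‖) y :=
        tendsto_finsetSum _ fun k _ =>
          (differentiableAt_of_contDiffOn hU (he.contDiffOn_dualForm hg k)
            (hVU hy)).continuousAt.norm
      refine ⟨∑ k, ‖dualForm g e k y‖ + 1, ?_⟩
      filter_upwards [hc.eventually (gt_mem_nhds (lt_add_one _)), hV.mem_nhds hy] with z hz hzV
      refine le_trans ?_ (mul_le_mul_of_nonneg_right hz.le (norm_nonneg _))
      rw [Finset.sum_mul]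
      refine norm_sum_le_of_le _ fun k _ => ?_
      rw [norm_smul, mul_comm]
      exact mul_le_mul_of_nonneg_left (hPu z hzV k) (norm_nonneg _)) hx h0 hx₀
    rw [hs₀, hδ] at h
    exact one_ne_zero h
  -- The shift by δ_i lets one formula serve all rows of `L`: it gives -Q_0 / s_0 for i = 0 and Q_i
  -- - (s_i / s_0) Q_0 for i ≠ 0.
  let τ : Fin n → E n → ℝ := fun i x => (s i x + δ i) * (s 0 x)⁻¹
  have hτ : ∀ x ∈ V, ∀ i, τ i x * s 0 x = s i x + δ i := fun x hx i => by
    simp only [τ]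
    rw [mul_assoc, inv_mul_cancel₀ (hne x hx), mul_one]
  let L : E n → Matrix (Fin n) (Fin n) ℝ := fun x => Matrix.of fun i k => Q i k x - τ i x * Q 0 k x
  have hLapp : ∀ x i k, L x i k = Q i k x - τ i x * Q 0 k x := fun _ _ _ => rfl
  have hLO : ∀ x ∈ V, L x ∈ Matrix.orthogonalGroup (Fin n) ℝ := by
    intro x hx
    rw [Matrix.mem_orthogonalGroup_iff]
    ext i j
    have h1 : (L x * (L x)ᵀ) i j = ∑ k, L x i k * L x j k := Matrix.mul_apply
    have h2 : ∀ k, L x i k * L x j k = Q i k x * Q j k x - τ j x * (Q i k x * Q 0 k x)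
        - τ i x * (Q j k x * Q 0 k x) + τ i x * τ j x * (Q 0 k x * Q 0 k x) := fun k => by
      rw [hLapp, hLapp]
      ring
    have h3 : ∀ i : Fin n, (if i = 0 then (1 : ℝ) else 0) - δ i * δ 0 = 0 := fun i => by
      rw [hδ, mul_one]
      exact sub_self _
    rw [h1, Matrix.one_apply]
    simp only [h2, Finset.sum_add_distrib, Finset.sum_sub_distrib, ← Finset.mul_sum, hprod x hx,
      h3, add_zero]
    have hi := hτ x hx i
    have hj := hτ x hx j
    simp only [if_true, hδ]
    linear_combination (-s j x + τ j x * s 0 x) * hi + (-s i x + s i x + δ i) * hj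
  have hL : ∀ x ∈ V, ∀ i k, HasFDerivAt (fun y => L y i k) (solutionDeriv g e L x i k) x := by
    intro x hx i k
    have hinv := (hasDerivAt_inv (hne x hx)).comp_hasFDerivAt x (hs 0 x hx)
    have h1 := (hQ i x hx k).sub
      ((((hs i x hx).add_const (δ i)).mul hinv).mul (hQ 0 x hx k))
    refine h1.congr_fderiv ?_
    ext X
    have hu := hne x hx
    have hδi : (if i = 0 then dualForm g e k x else 0) X = δ i * dualForm g e k x X := by
      simp only [δ]
      split_ifs <;> simp
    simp only [solutionDeriv, sub_apply, hδi, add_apply, sum_apply, smul_apply, smul_eq_mul,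
      hLapp, sub_mul, Finset.sum_sub_distrib, mul_assoc, ← Finset.mul_sum, Function.comp_apply,
      Pi.mul_apply]
    simp only [τ, hδ]
    field_simp
    ring
  refine ⟨L, fun i k => ?_, isSolutionOn_of_hasFDerivAt hg hU he hVU hLO hL, ?_⟩
  · exact (hQs i k).sub ((((hss i).add contDiffOn_const).mul ((hss 0).inv hne)).mul (hQs 0 k))
  · ext i k
    rw [hLapp]
    simp only [τ, hQ₀, hs₀, hδ, δ]
    split_ifs with hi
    · subst hi; norm_num; ring
    · norm_num

end RiemannianChart

end

theorem theorem4 {n : ℕ} [NeZero n] (U : Set (RiemannianChart.E n)) (hU : IsOpen U)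
    (g : RiemannianChart.E n → Matrix (Fin n) (Fin n) ℝ)
    (hg : RiemannianChart.IsMetricOn g U)
    (hK : RiemannianChart.HasConstSectionalCurvature g U (-1))
    (e : Fin n → RiemannianChart.E n → RiemannianChart.E n)
    (he : RiemannianChart.IsOrthonormalFrame g U e) :
    -- existence, for every initial value, on every simply connected open set `V ⊆ U`
    -- (in particular on `U` itself if it is simply connected, and on balls around any point)
    (∀ V ⊆ U, IsOpen V → IsSimplyConnected V → ∀ x₀ ∈ V,
      ∀ L₀ ∈ Matrix.orthogonalGroup (Fin n) ℝ,
        ∃ L : RiemannianChart.E n → Matrix (Fin n) (Fin n) ℝ,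
          (∀ i j, ContDiffOn ℝ ∞ (fun x => L x i j) V) ∧
          RiemannianChart.IsSolutionOn g e V L ∧ L x₀ = L₀ ∧
          RiemannianChart.IsOrthonormalFrame g V (fun i x => ∑ j, L x i j • e j x)) ∧
    -- uniqueness on every connected open set `V ⊆ U`
    (∀ V ⊆ U, IsOpen V → IsPreconnected V → ∀ x₀ ∈ V,
      ∀ L L' : RiemannianChart.E n → Matrix (Fin n) (Fin n) ℝ,
        RiemannianChart.IsSolutionOn g e V L → RiemannianChart.IsSolutionOn g e V L' →
        L x₀ = L' x₀ → Set.EqOn L L' V) ∧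
    -- for every solution, `∑ L_1k ω_k` is closed
    (∀ V ⊆ U, IsOpen V → ∀ L : RiemannianChart.E n → Matrix (Fin n) (Fin n) ℝ,
      RiemannianChart.IsSolutionOn g e V L →
        RiemannianChart.IsClosedFormOn
          (fun x => ∑ k, L x 0 k • RiemannianChart.dualForm g e k x) V) := by
  refine ⟨fun V hVU hV hVs x₀ hx₀ L₀ hL₀ => ?_, fun V hVU hV hVc x₀ hx₀ L L' hL hL' h0 => ?_,
    fun V hVU hV L hL => ?_⟩
  · obtain ⟨L, hLs, hL, hL0⟩ :=
      RiemannianChart.exists_isSolutionOn hg hU hK he hVU hV hVs hx₀ hL₀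
    exact ⟨L, hLs, hL, hL0,
      RiemannianChart.isOrthonormalFrame_of_orthogonal he hVU hLs hL.orthogonal⟩
  · exact hL.eqOn hL' hg hU he hVU hV hVc hx₀ h0
  · exact hL.isClosedFormOn hg hU he hVU hV
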